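/- Let $n\ge 1$ and let $w$ be a weight, that is, a nonnegative function on $(0,\infty)$ which is locally integrable on $[0,\infty)$, and assume that $w$ is not almost everywhere zero. For a measurable function $f:\mathbb{R}^n\to\mathbb{R}$ let $$f^*(t)=\inf\{s\ge 0:\ |\{x\in\mathbb{R}^n: |f(x)|>s\}|\le t\}\in[0,\infty],\qquad f^{**}(t)=\frac1t\int_0^t f^*(s)\,ds\qquad(t>0)$$ be its decreasing rearrangement and its maximal function. For $1<\alpha\le q<\infty$ let $\Gamma^q_\alpha(w)$ be the set of all measurable $f:\mathbb{R}^n\to\mathbb{R}$, functions that agree almost everywhere being identified, for which $$\|f\|_{\Gamma^q_\alpha(w)}=\left(\int_0^\infty (f^*(t))^{\alpha}\,(f^{**}(t))^{q-\alpha}\,w(t)\,dt\right)^{1/q}<\infty .$$ Theorem. Let $1<\alpha\le q<\infty$. Then $\Gamma^q_\alpha(w)$ is a Banach space (that is, it is a vector space and there is a complete norm $\|\cdot\|$ on it and a constant $C>1$ with $C^{-1}\|f\|_{\Gamma^q_\alpha(w)}\le\|f\|\le C\|f\|_{\Gamma^q_\alpha(w)}$ for all $f\in\Gamma^q_\alpha(w)$)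 if and only if $w\in B_q$, that is, if and only if there is a constant $C<\infty$ such that $$\int_r^\infty \frac{w(s)}{s^q}\,ds\le \frac{C}{r^q}\int_0^r w(s)\,ds\qquad\text{for all } r>0 .$$ -/

import Mathlib

open Set MeasureTheory
open scoped ENNReal NNReal

noncomputable section

namespace GammaLorentz

/-- A weight: a nonnegative function on `(0, ∞)`, locally integrable on `[0, ∞)` (which includes
almost everywhere measurability). The values outside `(0, ∞)` play no role. -/
structure IsWeight (w : ℝ → ℝ) : Prop where
  nonneg : ∀ t, 0 < t → 0 ≤ w t
  locallyIntegrableOn : LocallyIntegrableOn w (Ici 0) volume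

/-- The class `B_q`: there is a finite constant `C` such that
`∫_r^∞ w(s) / s^q ds ≤ (C / r^q) ∫_0^r w(s) ds` for all `r > 0`. -/
def IsBq (q : ℝ) (w : ℝ → ℝ) : Prop :=
  ∃ C : ℝ, 0 < C ∧ ∀ r : ℝ, 0 < r →
    ∫⁻ s in Ioi r, ENNReal.ofReal (w s / s ^ q) ≤
      ENNReal.ofReal (C / r ^ q) * ∫⁻ s in Ioo 0 r, ENNReal.ofReal (w s)

/-- The decreasing rearrangement `f^*(t) = inf {s ≥ 0 : μ {x : |f x| > s} ≤ t}`, with values in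
`[0, ∞]` (the infimum of the empty set of finite `s` is `∞`). -/
def decRearrangement {Ω : Type*} [MeasurableSpace Ω] (μ : Measure Ω) (f : Ω → ℝ) (t : ℝ) : ℝ≥0∞ :=
  sInf {s : ℝ≥0∞ | μ {x | s < ENNReal.ofReal |f x|} ≤ ENNReal.ofReal t}

/-- The Hardy operator `S g (t) = (1 / t) ∫_0^t g(s) ds`, for `t > 0`. -/
def hardyOp (g : ℝ → ℝ≥0∞) (t : ℝ) : ℝ≥0∞ :=
  (ENNReal.ofReal t)⁻¹ * ∫⁻ s in Ioo 0 t, g s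

/-- The maximal function `f^{**} = S f^*`. -/
def maximalFun {Ω : Type*} [MeasurableSpace Ω] (μ : Measure Ω) (f : Ω → ℝ) (t : ℝ) : ℝ≥0∞ :=
  hardyOp (decRearrangement μ f) t

/-- The functional `‖f‖ = (∫_0^∞ f^*(t)^α f^{**}(t)^(q - α) w(t) dt)^(1/q)`, in `[0, ∞]`. -/
def gammaNorm {Ω : Type*} [MeasurableSpace Ω] (μ : Measure Ω) (q α : ℝ) (w : ℝ → ℝ) (f : Ω → ℝ) :
    ℝ≥0∞ :=
  (∫⁻ t in Ioi (0 : ℝ), decRearrangement μ f t ^ α * maximalFun μ f t ^ (q - α) *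
    ENNReal.ofReal (w t)) ^ (1 / q)

/-- The space `Γ^q_α(w)` over a measure space, as a set of classes of a.e. equal measurable
real functions. It need not be closed under addition. -/
def gammaSpace {Ω : Type*} [MeasurableSpace Ω] (μ : Measure Ω) (q α : ℝ) (w : ℝ → ℝ) :
    Set (Ω →ₘ[μ] ℝ) :=
  {f | gammaNorm μ q α w f < ∞}

/-- `Γ^q_α(w)` is a Banach space: it is a vector space and carries a complete norm that is
equivalent to the defining functional. -/
def GammaIsBanach {Ω : Type*} [MeasurableSpace Ω] (μ : Measure Ω) (q α : ℝ) (w : ℝ → ℝ) : Prop :=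
  ∃ X : Submodule ℝ (Ω →ₘ[μ] ℝ), (X : Set (Ω →ₘ[μ] ℝ)) = gammaSpace μ q α w ∧
    ∃ (_ : Norm X) (core : NormedSpace.Core ℝ X),
      (@CompleteSpace X (NormedAddCommGroup.ofCore core).toMetricSpace.toUniformSpace) ∧
      ∃ C : ℝ, 1 < C ∧ ∀ f : X,
        C⁻¹ * (gammaNorm μ q α w (f : Ω →ₘ[μ] ℝ)).toReal ≤ ‖f‖ ∧
          ‖f‖ ≤ C * (gammaNorm μ q α w (f : Ω →ₘ[μ] ℝ)).toReal

end GammaLorentz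

end

/-! Write `W(r)` for the integral of `w` over `(0, r)`.

If `w ∈ B_q`, the norm is the `L^q(w)` norm of `f^{**}` (`maximalNorm`). It is subadditive because
`f^{**}` is, and it dominates the functional because `f^* ≤ f^{**}`. The reverse estimate is Hardy's
inequality `hardy_antitone`. The chain rule for the primitive of `f^*` writes `(f^{**})^q` as an
integral of the decreasing function `f^* (f^{**})^(q-1)`, and `B_q` then bounds `∫ (f^{**})^q w` by
a multiple of `∫ f^* (f^{**})^(q-1) w`. A Young type splitting (`mul_rpow_le_add`) trades this
integrand for `(f^*)^α (f^{**})^(q-α)` plus a small multiple of `(f^{**})^q`, which is absorbed.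
Completeness follows from Borel–Cantelli and Fatou (`exists_limit_of_maximalNorm_lt`).

Conversely, let the space be normable, and take a step function with values `a_j ≥ 0` on `M`
disjoint cells of measure `r`. Its `M` cyclic shifts are equimeasurable and add up to the constant
`∑ a_j` on the union of the cells, so `(∑ a_j)^q W(M r)` is at most `D M^q` times the `q`-th power
of the functional of one shift (`GammaIsBanach.exists_average_le`). A single nonzero value gives
`W(M r) ≤ D M^q W(r)`. The values `1 / (j + 1)` with `M = 2^K` and harmonic sum `H` give `f^* ≤ min
1 (r / t)` and `f^{**} ≤ H min 1 (r / t)`, whence `H^α W(2^K r) ≤ D (1 + K D 2^q) 2^(K q) W(r)`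
(`harmonic_rpow_mul_weight_le`). Since `H ≥ K log 2` and `α > 1`, the left factor beats the linear
growth in `K`. So for some `l = 2^K` one has `2 W(l r) ≤ l^q W(r)` for all `r`, and iteration yields
`B_q` (`isBq_of_two_mul_le`). -/

noncomputable section

open Filter Topology

namespace GammaLorentz

/-! ### Decreasing rearrangement and maximal function -/

section

variable {Ω : Type*} [MeasurableSpace Ω] {μ : Measure Ω}

/-- The layer cake formula for functions with values in `[0, ∞]`. -/
lemma lintegral_eq_lintegral_meas_ofReal_lt {g : Ω → ℝ≥0∞} (hg : AEMeasurable g μ) :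
    ∫⁻ x, g x ∂μ = ∫⁻ s in Ioi (0 : ℝ), μ {x | ENNReal.ofReal s < g x} := by
  by_cases h : μ {x | g x = ∞} = 0
  · have hfin : ∀ᵐ x ∂μ, g x ≠ ∞ := by rw [ae_iff]; simpa using h
    have h1 : ∫⁻ x, g x ∂μ = ∫⁻ x, ENNReal.ofReal (g x).toReal ∂μ :=
      lintegral_congr_ae (hfin.mono fun x hx => (ENNReal.ofReal_toReal hx).symm)
    rw [h1, lintegral_eq_lintegral_meas_lt μ (Eventually.of_forall fun x => ENNReal.toReal_nonneg)
      hg.ennreal_toReal]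
    refine setLIntegral_congr_fun measurableSet_Ioi fun s hs => ?_
    refine measure_congr ?_
    filter_upwards [hfin] with x hx
    exact propext (ENNReal.ofReal_lt_iff_lt_toReal (le_of_lt hs) hx).symm
  · rw [lintegral_eq_top_of_measure_eq_top_ne_zero hg h, eq_comm, eq_top_iff]
    calc (∞ : ℝ≥0∞) = ∫⁻ _ in Ioi (0 : ℝ), μ {x | g x = ∞} := by
          simp [ENNReal.mul_top h]
      _ ≤ _ := lintegral_mono fun s => measure_mono fun x (hx : g x = ∞) => by
          simp [hx]

lemma decRearrangement_antitone (f : Ω → ℝ) : Antitone (decRearrangement μ f) := fun _ _ hst =>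
  sInf_le_sInf fun _ ha => le_trans ha (ENNReal.ofReal_le_ofReal hst)

/-- The infimum that defines the decreasing rearrangement is attained. -/
lemma decRearrangement_le_iff {f : Ω → ℝ} {t : ℝ} {s : ℝ≥0∞} :
    decRearrangement μ f t ≤ s ↔ μ {x | s < ENNReal.ofReal |f x|} ≤ ENNReal.ofReal t := by
  refine ⟨fun h => ?_, fun h => sInf_le h⟩
  rcases eq_or_ne s ∞ with rfl | hs
  · simp
  -- As levels decrease to `s`, the superlevel sets increase to the one at `s`, so continuity of the
  -- measure from below suffices.
  obtain ⟨u, hu, hmem, hlim⟩ := exists_seq_strictAnti_tendsto' (lt_top_iff_ne_top.2 hs)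
  have hset : {x | s < ENNReal.ofReal |f x|} = ⋃ n, {x | u n < ENNReal.ofReal |f x|} := by
    ext x
    simp only [mem_ofPred_eq, mem_iUnion]
    refine ⟨fun hx => ?_, fun ⟨n, hn⟩ => (hmem n).1.trans hn⟩
    exact (hlim.eventually (gt_mem_nhds hx)).exists
  have hmono : Monotone fun n => {x | u n < ENNReal.ofReal |f x|} :=
    fun m n hmn x hx => lt_of_le_of_lt (hu.antitone hmn) hx
  rw [hset, hmono.measure_iUnion]
  refine iSup_le fun n => ?_
  obtain ⟨a, ha, han⟩ := sInf_lt_iff.1 (lt_of_le_of_lt h (hmem n).1)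
  exact le_trans (measure_mono fun x hx => han.trans hx) ha

lemma lt_decRearrangement_iff {f : Ω → ℝ} {t : ℝ} {s : ℝ≥0∞} :
    s < decRearrangement μ f t ↔ ENNReal.ofReal t < μ {x | s < ENNReal.ofReal |f x|} := by
  rw [← not_le, decRearrangement_le_iff, not_le]

lemma decRearrangement_congr_ae {f g : Ω → ℝ} (h : f =ᵐ[μ] g) :
    decRearrangement μ f = decRearrangement μ g := by
  funext t
  refine eq_of_forall_ge_iff fun s => ?_
  rw [decRearrangement_le_iff, decRearrangement_le_iff]
  have : μ {x | s < ENNReal.ofReal |f x|} = μ {x | s < ENNReal.ofReal |g x|} := by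
    refine measure_congr ?_
    filter_upwards [h] with x hx
    exact congrArg (fun y => s < ENNReal.ofReal |y|) hx
  rw [this]

lemma gammaNorm_congr_ae {f g : Ω → ℝ} (h : f =ᵐ[μ] g) (q α : ℝ) (w : ℝ → ℝ) :
    gammaNorm μ q α w f = gammaNorm μ q α w g := by
  simp only [gammaNorm, maximalFun, decRearrangement_congr_ae h]

lemma decRearrangement_smul (c : ℝ) (hc : c ≠ 0) (f : Ω → ℝ) (t : ℝ) :
    decRearrangement μ (c • f) t = ENNReal.ofReal |c| * decRearrangement μ f t := by
  have hc0 : ENNReal.ofReal |c| ≠ 0 := by simpa using hc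
  refine eq_of_forall_ge_iff fun s => ?_
  rw [mul_comm, ← ENNReal.le_div_iff_mul_le (Or.inl hc0) (Or.inl ENNReal.ofReal_ne_top),
    decRearrangement_le_iff, decRearrangement_le_iff]
  have : {x | s < ENNReal.ofReal |(c • f) x|} =
      {x | s / ENNReal.ofReal |c| < ENNReal.ofReal |f x|} := by
    ext x
    simp only [mem_ofPred_eq, Pi.smul_apply, smul_eq_mul, abs_mul]
    rw [ENNReal.ofReal_mul (abs_nonneg c), ENNReal.div_lt_iff (Or.inl hc0)
      (Or.inl ENNReal.ofReal_ne_top), mul_comm]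
  rw [this]

lemma volume_ofReal_lt (m : ℝ≥0∞) :
    (volume.restrict (Ioi (0 : ℝ))) {t | ENNReal.ofReal t < m} = m := by
  rcases eq_or_ne m ∞ with rfl | hm
  · simp
  rw [Measure.restrict_apply' measurableSet_Ioi]
  have : {t : ℝ | ENNReal.ofReal t < m} ∩ Ioi 0 = Ioo 0 m.toReal := by
    ext t
    simp only [mem_inter_iff, mem_ofPred_eq, mem_Ioi, mem_Ioo]
    constructor
    · rintro ⟨h, ht⟩
      exact ⟨ht, (ENNReal.ofReal_lt_iff_lt_toReal ht.le hm).1 h⟩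
    · rintro ⟨ht, h⟩
      exact ⟨(ENNReal.ofReal_lt_iff_lt_toReal ht.le hm).2 h, ht⟩
  rw [this, Real.volume_Ioo, sub_zero, ENNReal.ofReal_toReal hm]

/-- `f` and its decreasing rearrangement have the same integrals above each level. -/
lemma lintegral_decRearrangement_sub {f : Ω → ℝ} (hf : AEMeasurable f μ) {l : ℝ≥0∞} :
    ∫⁻ t in Ioi (0 : ℝ), (decRearrangement μ f t - l) =
      ∫⁻ x, (ENNReal.ofReal |f x| - l) ∂μ := by
  have hm : Measurable (decRearrangement μ f) := (decRearrangement_antitone f).measurable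
  have hm' : AEMeasurable (fun x => ENNReal.ofReal |f x| - l) μ :=
    (ENNReal.measurable_ofReal.comp_aemeasurable
      (continuous_abs.measurable.comp_aemeasurable hf)).sub_const l
  rw [lintegral_eq_lintegral_meas_ofReal_lt (hm.sub_const l).aemeasurable,
    lintegral_eq_lintegral_meas_ofReal_lt hm']
  refine setLIntegral_congr_fun measurableSet_Ioi fun s _ => ?_
  -- The `t` with `f^*(t) > λ` are those below `μ {|f| > λ}`, and they form a set of exactly that
  -- length.
  simp only [lt_tsub_iff_right, lt_decRearrangement_iff]
  exact volume_ofReal_lt _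

/-- Half of the variational formula `∫_0^t f^* = min_l (l t + ∫ (|f| - l)_+)`, from `f^* ≤ l + (f^*
- l)_+` and equimeasurability. Its purpose is the subadditivity of `f^{**}`. -/
lemma setLIntegral_decRearrangement_le {f : Ω → ℝ} (hf : AEMeasurable f μ) (t : ℝ) (l : ℝ≥0∞) :
    ∫⁻ s in Ioo 0 t, decRearrangement μ f s ≤
      l * ENNReal.ofReal t + ∫⁻ x, (ENNReal.ofReal |f x| - l) ∂μ := by
  rw [← lintegral_decRearrangement_sub hf]
  calc ∫⁻ s in Ioo 0 t, decRearrangement μ f s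
      ≤ ∫⁻ s in Ioo 0 t, (l + (decRearrangement μ f s - l)) :=
        lintegral_mono fun s => le_add_tsub
    _ = l * ENNReal.ofReal t + ∫⁻ s in Ioo 0 t, (decRearrangement μ f s - l) := by
        rw [lintegral_add_left measurable_const]; simp
    _ ≤ _ := by gcongr; exact Ioo_subset_Ioi_self

/-- The minimum in that formula is reached at `l = f^*(t)`: by monotonicity `(f^* - l)_+` vanishes
from `t` on, and before `t` adding `l` restores `f^*`. -/
lemma le_setLIntegral_decRearrangement {f : Ω → ℝ} (hf : AEMeasurable f μ) (t : ℝ) :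
    decRearrangement μ f t * ENNReal.ofReal t +
      ∫⁻ x, (ENNReal.ofReal |f x| - decRearrangement μ f t) ∂μ ≤
      ∫⁻ s in Ioo 0 t, decRearrangement μ f s := by
  set l := decRearrangement μ f t with hl
  have hanti := decRearrangement_antitone (μ := μ) f
  rw [← lintegral_decRearrangement_sub hf]
  have h1 : ∫⁻ s in Ioi (0 : ℝ), (decRearrangement μ f s - l) =
      ∫⁻ s in Ioo 0 t, (decRearrangement μ f s - l) := by
    rw [← lintegral_indicator measurableSet_Ioi, ← lintegral_indicator measurableSet_Ioo]
    congr 1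
    funext s
    by_cases hs : s ∈ Ioo 0 t
    · rw [indicator_of_mem hs, indicator_of_mem (Ioo_subset_Ioi_self hs)]
    · rw [indicator_of_notMem hs]
      by_cases h0 : s ∈ Ioi (0 : ℝ)
      · rw [indicator_of_mem h0]
        exact tsub_eq_zero_of_le (hanti (not_lt.1 fun hst => hs ⟨h0, hst⟩))
      · rw [indicator_of_notMem h0]
  have h2 : l * ENNReal.ofReal t = ∫⁻ _ in Ioo 0 t, l := by simp
  rw [h1, h2, ← lintegral_add_left measurable_const]
  refine setLIntegral_mono hanti.measurable fun s hs => ?_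
  rw [add_tsub_cancel_of_le (hanti hs.2.le)]

lemma setLIntegral_decRearrangement_add_le {f g : Ω → ℝ} (hf : AEMeasurable f μ)
    (hg : AEMeasurable g μ) (t : ℝ) :
    ∫⁻ s in Ioo 0 t, decRearrangement μ (f + g) s ≤
      (∫⁻ s in Ioo 0 t, decRearrangement μ f s) + ∫⁻ s in Ioo 0 t, decRearrangement μ g s := by
  -- Testing at the sum of the two optimal levels works because `(|f + g| - l - m)_+ ≤ (|f| - l)_+ +
  -- (|g| - m)_+`.
  refine le_trans (setLIntegral_decRearrangement_le (hf.add hg) t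
    (decRearrangement μ f t + decRearrangement μ g t)) ?_
  refine le_trans ?_ (add_le_add (le_setLIntegral_decRearrangement hf t)
    (le_setLIntegral_decRearrangement hg t))
  rw [add_mul, add_add_add_comm]
  gcongr
  rw [← lintegral_add_left' (by fun_prop)]
  refine lintegral_mono fun x => ?_
  rw [tsub_le_iff_right]
  calc ENNReal.ofReal |(f + g) x| ≤ ENNReal.ofReal |f x| + ENNReal.ofReal |g x| := by
        rw [← ENNReal.ofReal_add (abs_nonneg _) (abs_nonneg _)]
        exact ENNReal.ofReal_le_ofReal (abs_add_le _ _)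
    _ ≤ (ENNReal.ofReal |f x| - decRearrangement μ f t + decRearrangement μ f t) +
        (ENNReal.ofReal |g x| - decRearrangement μ g t + decRearrangement μ g t) :=
        add_le_add le_tsub_add le_tsub_add
    _ = _ := by ring

/-- The maximal function is subadditive. -/
lemma maximalFun_add_le {f g : Ω → ℝ} (hf : AEMeasurable f μ) (hg : AEMeasurable g μ) (t : ℝ) :
    maximalFun μ (f + g) t ≤ maximalFun μ f t + maximalFun μ g t := by
  simp only [maximalFun, hardyOp]
  rw [← mul_add]
  gcongr
  exact setLIntegral_decRearrangement_add_le hf hg t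

lemma maximalFun_smul (c : ℝ) (hc : c ≠ 0) (f : Ω → ℝ) (t : ℝ) :
    maximalFun μ (c • f) t = ENNReal.ofReal |c| * maximalFun μ f t := by
  simp only [maximalFun, hardyOp, decRearrangement_smul c hc f]
  rw [lintegral_const_mul _ (decRearrangement_antitone f).measurable]
  ring

lemma maximalFun_congr_ae {f g : Ω → ℝ} (h : f =ᵐ[μ] g) : maximalFun μ f = maximalFun μ g := by
  funext t
  simp only [maximalFun, decRearrangement_congr_ae h]

/-- Lower semicontinuity of the rearrangement under almost everywhere convergence. -/
lemma decRearrangement_le_liminf {f : Ω → ℝ} {u : ℕ → Ω → ℝ}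
    (h : ∀ᵐ x ∂μ, Tendsto (fun n => u n x) atTop (𝓝 (f x))) (t : ℝ) :
    decRearrangement μ f t ≤ liminf (fun n => decRearrangement μ (u n) t) atTop := by
  refine le_of_forall_gt_imp_ge_of_dense fun s hs => ?_
  rw [decRearrangement_le_iff]
  have hfreq : ∃ᶠ n in atTop, decRearrangement μ (u n) t < s := frequently_lt_of_liminf_lt
    (by isBoundedDefault) hs
  have hmono : Monotone fun N : ℕ => ⋂ n ≥ N, {x | s < ENNReal.ofReal |u n x|} :=
    fun M N hMN => biInter_subset_biInter_left fun n hn => le_trans hMN hn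
  calc μ {x | s < ENNReal.ofReal |f x|}
      ≤ μ (⋃ N : ℕ, ⋂ n ≥ N, {x | s < ENNReal.ofReal |u n x|}) := by
        refine measure_mono_ae ?_
        filter_upwards [h] with x hx hsx
        have h1 : Tendsto (fun n => ENNReal.ofReal |u n x|) atTop (𝓝 (ENNReal.ofReal |f x|)) :=
          ENNReal.tendsto_ofReal hx.abs
        obtain ⟨N, hN⟩ := eventually_atTop.1 (h1.eventually (lt_mem_nhds hsx))
        exact mem_iUnion.2 ⟨N, mem_iInter₂.2 fun i hi => hN i hi⟩
    _ = ⨆ N : ℕ, μ (⋂ n ≥ N, {x | s < ENNReal.ofReal |u n x|}) := hmono.measure_iUnion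
    _ ≤ ENNReal.ofReal t := iSup_le fun N => by
        obtain ⟨n, hn, hns⟩ := frequently_atTop.1 hfreq N
        exact (measure_mono (biInter_subset_of_mem hn)).trans (decRearrangement_le_iff.1 hns.le)

lemma measurable_hardyOp (g : ℝ → ℝ≥0∞) : Measurable (hardyOp g) := by
  refine (ENNReal.measurable_ofReal.inv).mul (Monotone.measurable fun s t hst => ?_)
  exact lintegral_mono_set (Ioo_subset_Ioo_right hst)

lemma hardyOp_mono {g h : ℝ → ℝ≥0∞} (hgh : ∀ s, g s ≤ h s) (t : ℝ) :
    hardyOp g t ≤ hardyOp h t := by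
  unfold hardyOp
  gcongr
  exact hgh _

lemma maximalFun_le_liminf {f : Ω → ℝ} {u : ℕ → Ω → ℝ}
    (h : ∀ᵐ x ∂μ, Tendsto (fun n => u n x) atTop (𝓝 (f x))) (t : ℝ) :
    maximalFun μ f t ≤ liminf (fun n => maximalFun μ (u n) t) atTop := by
  unfold maximalFun hardyOp
  rcases le_or_gt t 0 with ht | ht
  · simp [ht]
  have hne : (ENNReal.ofReal t)⁻¹ ≠ ∞ := by simpa using ht
  calc _ ≤ (ENNReal.ofReal t)⁻¹ *
        ∫⁻ s in Ioo 0 t, liminf (fun n => decRearrangement μ (u n) s) atTop := by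
        gcongr
        exact decRearrangement_le_liminf h _
    _ ≤ (ENNReal.ofReal t)⁻¹ *
        liminf (fun n => ∫⁻ s in Ioo 0 t, decRearrangement μ (u n) s) atTop := by
        gcongr
        exact lintegral_liminf_le fun n => (decRearrangement_antitone _).measurable
    _ = _ := ENNReal.liminf_const_mul_of_ne_top hne |>.symm

/-- A decreasing function is dominated by its averages. -/
lemma le_hardyOp {g : ℝ → ℝ≥0∞} (hg : Antitone g) {t : ℝ} (ht : 0 < t) : g t ≤ hardyOp g t := by
  unfold hardyOp
  rw [mul_comm, ← div_eq_mul_inv, ENNReal.le_div_iff_mul_le (by simp [ht]) (by simp)]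
  calc g t * ENNReal.ofReal t = ∫⁻ _ in Ioo 0 t, g t := by simp
    _ ≤ _ := setLIntegral_mono hg.measurable fun s hs => hg hs.2.le

/-- On `[s, t)` one has `g ≤ g s ≤ S g s`, so extending the average from `s` to `t` cannot raise it.
Only positive arguments count, since `hardyOp` is `0` at `t ≤ 0`. -/
lemma hardyOp_antitoneOn {g : ℝ → ℝ≥0∞} (hg : Antitone g) :
    AntitoneOn (hardyOp g) (Ioi 0) := by
  intro s hs t ht hst
  simp only [mem_Ioi] at hs ht
  have h1 : ∫⁻ u in Ioo 0 t, g u ≤ (∫⁻ u in Ioo 0 s, g u) + g s * ENNReal.ofReal (t - s) := by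
    calc ∫⁻ u in Ioo 0 t, g u ≤ ∫⁻ u in Ioo 0 s ∪ Ico s t, g u := by
          refine lintegral_mono_set fun u hu => ?_
          rcases lt_or_ge u s with h | h
          · exact Or.inl ⟨hu.1, h⟩
          · exact Or.inr ⟨h, hu.2⟩
      _ ≤ (∫⁻ u in Ioo 0 s, g u) + ∫⁻ u in Ico s t, g u := lintegral_union_le _ _ _
      _ ≤ (∫⁻ u in Ioo 0 s, g u) + ∫⁻ _ in Ico s t, g s := by
          gcongr _ + ?_
          exact setLIntegral_mono measurable_const fun u hu => hg hu.1
      _ = _ := by simp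
  have h2 : ENNReal.ofReal s * hardyOp g s = ∫⁻ u in Ioo 0 s, g u := by
    unfold hardyOp
    rw [← mul_assoc, ENNReal.mul_inv_cancel (by simp [hs]) (by simp), one_mul]
  calc hardyOp g t
      ≤ (ENNReal.ofReal t)⁻¹ * (ENNReal.ofReal s * hardyOp g s +
          hardyOp g s * ENNReal.ofReal (t - s)) := by
        rw [h2]
        unfold hardyOp
        exact mul_le_mul_right (h1.trans (by gcongr; exact le_hardyOp hg hs)) _
    _ = (ENNReal.ofReal t)⁻¹ * (ENNReal.ofReal t * hardyOp g s) := by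
        rw [mul_comm (hardyOp g s), ← add_mul, ← ENNReal.ofReal_add hs.le (sub_nonneg.2 hst)]
        simp
    _ = hardyOp g s := by
        rw [← mul_assoc, ENNReal.inv_mul_cancel (by simp [ht]) (by simp), one_mul]

lemma eq_zero_of_decRearrangement_eq_zero {f : Ω → ℝ}
    (h : ∀ t : ℝ, 0 < t → decRearrangement μ f t = 0) : f =ᵐ[μ] 0 := by
  have h0 : μ {x | 0 < ENNReal.ofReal |f x|} = 0 := by
    refine le_antisymm (ENNReal.le_of_forall_pos_le_add fun ε hε _ => ?_) zero_le
    have := decRearrangement_le_iff.1 (h ε (by exact_mod_cast hε)).le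
    simpa using this
  have h1 : ∀ᵐ x ∂μ, ¬ (0 < ENNReal.ofReal |f x|) := by
    rw [ae_iff]; simpa using h0
  filter_upwards [h1] with x hx
  simpa using hx

end

/-! ### Integral inequalities for decreasing functions -/

/-- An inequality between two measures on the intervals `(0, r)` gives the inequality between the
integrals of decreasing functions. -/
lemma lintegral_antitoneOn_le {ν₁ ν₂ : Measure ℝ} [NullSingletonClass ν₁] {C : ℝ≥0∞}
    (hν : ∀ r : ℝ, 0 < r → ν₁ (Ioo 0 r) ≤ C * ν₂ (Ioo 0 r)) {h : ℝ → ℝ≥0∞} (hm : Measurable h)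
    (hh : AntitoneOn h (Ioi 0)) :
    ∫⁻ s in Ioi 0, h s ∂ν₁ ≤ C * ∫⁻ s in Ioi 0, h s ∂ν₂ := by
  rw [lintegral_eq_lintegral_meas_ofReal_lt hm.aemeasurable,
    lintegral_eq_lintegral_meas_ofReal_lt hm.aemeasurable, ← lintegral_const_mul]
  swap
  · refine Antitone.measurable fun s t hst => measure_mono fun x hx => ?_
    exact lt_of_le_of_lt (ENNReal.ofReal_le_ofReal hst) hx
  refine lintegral_mono fun l => ?_
  rw [Measure.restrict_apply' measurableSet_Ioi, Measure.restrict_apply' measurableSet_Ioi]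
  set A := {x | ENNReal.ofReal l < h x} ∩ Ioi 0 with hA
  -- Superlevel sets of a decreasing function are initial intervals of `(0, ∞)`, so the hypothesis
  -- applies to them up to an endpoint, which is null for `ν₁`.
  have hlow : ∀ a ∈ A, ∀ s, 0 < s → s ≤ a → s ∈ A := fun a ha s hs hsa =>
    ⟨lt_of_lt_of_le ha.1 (hh hs ha.2 hsa), hs⟩
  by_cases hbdd : BddAbove A
  · rcases A.eq_empty_or_nonempty with he | hne
    · simp [he]
    have hsub : A ⊆ Ioc 0 (sSup A) := fun a ha => ⟨ha.2, le_csSup hbdd ha⟩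
    have hsup : Ioo 0 (sSup A) ⊆ A := fun s hs => by
      obtain ⟨a, ha, hsa⟩ := exists_lt_of_lt_csSup hne hs.2
      exact hlow a ha s hs.1 hsa.le
    have hpos : 0 < sSup A := by
      obtain ⟨a, ha⟩ := hne
      exact lt_of_lt_of_le ha.2 (le_csSup hbdd ha)
    calc ν₁ A ≤ ν₁ (Ioc 0 (sSup A)) := measure_mono hsub
      _ = ν₁ (Ioo 0 (sSup A)) := measure_congr Ioo_ae_eq_Ioc.symm
      _ ≤ C * ν₂ (Ioo 0 (sSup A)) := hν _ hpos
      _ ≤ C * ν₂ A := by gcongr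
  · have hall : A = ⋃ n : ℕ, Ioo (0 : ℝ) (n + 1) := by
      ext s
      simp only [mem_iUnion, mem_Ioo]
      constructor
      · intro hs
        obtain ⟨n, hn⟩ := exists_nat_gt s
        exact ⟨n, hs.2, by linarith⟩
      · rintro ⟨n, hs, -⟩
        rw [not_bddAbove_iff] at hbdd
        obtain ⟨a, ha, hsa⟩ := hbdd s
        exact hlow a ha s hs hsa.le
    have hmono : Monotone fun n : ℕ => Ioo (0 : ℝ) (n + 1) := fun m n hmn =>
      Ioo_subset_Ioo_right (by have : (m : ℝ) ≤ n := by exact_mod_cast hmn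
                               linarith)
    have h1 : ν₁ A = ⨆ n : ℕ, ν₁ (Ioo (0 : ℝ) (n + 1)) := by rw [hall, hmono.measure_iUnion]
    rw [h1]
    refine iSup_le fun n => (hν _ (by positivity)).trans ?_
    gcongr
    rw [hall]
    exact subset_iUnion (fun n : ℕ => Ioo (0 : ℝ) (n + 1)) n

/-- Tonelli on the triangle `0 < s < t`. Almost everywhere measurability is all that is asked of
`u`, which will carry the weight. -/
lemma lintegral_mul_primitive {k u : ℝ → ℝ≥0∞} (hk : Measurable k)
    (hu : AEMeasurable u (volume.restrict (Ioi 0))) :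
    ∫⁻ t in Ioi (0 : ℝ), u t * ∫⁻ s in Ioo 0 t, k s =
      ∫⁻ s in Ioi (0 : ℝ), k s * ∫⁻ t in Ioi s, u t := by
  have hmeas : AEMeasurable (Function.uncurry fun t s : ℝ => if s < t then u t * k s else 0)
      ((volume.restrict (Ioi 0)).prod (volume.restrict (Ioi 0))) := by
    have h1 : AEMeasurable (fun p : ℝ × ℝ => u p.1 * k p.2)
        ((volume.restrict (Ioi 0)).prod (volume.restrict (Ioi 0))) :=
      (hu.comp_quasiMeasurePreserving Measure.quasiMeasurePreserving_fst).mul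
        (hk.comp measurable_snd).aemeasurable
    have h2 := h1.indicator (s := {p : ℝ × ℝ | p.2 < p.1})
      (measurableSet_lt measurable_snd measurable_fst)
    exact h2
  have hswap := lintegral_lintegral_swap hmeas
  calc ∫⁻ t in Ioi (0 : ℝ), u t * ∫⁻ s in Ioo 0 t, k s
      = ∫⁻ t in Ioi (0 : ℝ), ∫⁻ s in Ioi (0 : ℝ), if s < t then u t * k s else 0 := by
        refine lintegral_congr fun t => ?_
        rw [← lintegral_const_mul _ hk, ← Ioi_inter_Iio, inter_comm, ← Measure.restrict_restrict
          measurableSet_Iio, ← lintegral_indicator measurableSet_Iio]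
        rfl
    _ = ∫⁻ s in Ioi (0 : ℝ), ∫⁻ t in Ioi (0 : ℝ), if s < t then u t * k s else 0 := hswap
    _ = _ := by
        refine setLIntegral_congr_fun measurableSet_Ioi fun s hs => ?_
        have hsub : Ioi s ⊆ Ioi (0 : ℝ) := Ioi_subset_Ioi (le_of_lt hs)
        rw [← lintegral_const_mul'' _ (hu.mono_measure (Measure.restrict_mono_set _ hsub))]
        have e : ∫⁻ t in Ioi s, k s * u t =
            ∫⁻ t in Ioi (0 : ℝ), (Ioi s).indicator (fun t => k s * u t) t := by
          rw [lintegral_indicator measurableSet_Ioi, Measure.restrict_restrict measurableSet_Ioi,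
            inter_eq_self_of_subset_left hsub]
        rw [e]
        refine lintegral_congr fun t => ?_
        simp only [indicator, mem_Ioi, mul_comm]

/-- The Hardy type operator with kernel `s ^ (q - 1) / t ^ q` is bounded on decreasing functions
when the weight is in `B_q`. -/
lemma lintegral_rpow_primitive_le {q : ℝ} (hq : 1 < q) {v : ℝ → ℝ≥0∞}
    (hv : AEMeasurable v (volume.restrict (Ioi 0))) {C : ℝ≥0∞}
    (hB : ∀ r : ℝ, 0 < r → ∫⁻ s in Ioi r, ENNReal.ofReal (s ^ (-q)) * v s ≤
      C * ENNReal.ofReal (r ^ (-q)) * ∫⁻ s in Ioo 0 r, v s)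
    {h : ℝ → ℝ≥0∞} (hm : Measurable h) (hh : AntitoneOn h (Ioi 0)) :
    ∫⁻ t in Ioi (0 : ℝ), (ENNReal.ofReal (t ^ (-q)) * v t) *
      ∫⁻ s in Ioo 0 t, h s * ENNReal.ofReal (s ^ (q - 1)) ≤
      (1 + C) * ∫⁻ s in Ioi (0 : ℝ), h s * v s := by
  have hu : AEMeasurable (fun t => ENNReal.ofReal (t ^ (-q)) * v t) (volume.restrict (Ioi 0)) :=
    AEMeasurable.mul (by fun_prop) hv
  set Φ : ℝ → ℝ≥0∞ := fun s => ∫⁻ t in Ioi s, ENNReal.ofReal (t ^ (-q)) * v t with hΦ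
  have hΦm : Measurable Φ :=
    Antitone.measurable fun a b hab => lintegral_mono_set (Ioi_subset_Ioi hab)
  have hpm : Measurable fun s : ℝ => ENNReal.ofReal (s ^ (q - 1)) := by fun_prop
  rw [lintegral_mul_primitive (k := fun s => h s * ENNReal.ofReal (s ^ (q - 1))) (hm.mul hpm) hu]
  set ν₁ : Measure ℝ := volume.withDensity fun s => ENNReal.ofReal (s ^ (q - 1)) * Φ s with hν₁
  set ν₂ : Measure ℝ := (volume.restrict (Ioi 0)).withDensity v with hν₂
  have e1 : ∫⁻ s in Ioi (0 : ℝ), h s * ENNReal.ofReal (s ^ (q - 1)) *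
      ∫⁻ t in Ioi s, ENNReal.ofReal (t ^ (-q)) * v t = ∫⁻ s in Ioi (0 : ℝ), h s ∂ν₁ := by
    rw [hν₁, restrict_withDensity measurableSet_Ioi,
      lintegral_withDensity_eq_lintegral_mul _
      (f := fun s => ENNReal.ofReal (s ^ (q - 1)) * Φ s) (hpm.mul hΦm) hm]
    refine lintegral_congr fun s => ?_
    simp only [Pi.mul_apply, hΦ]
    ring
  have e2 : ∫⁻ s in Ioi (0 : ℝ), h s * v s = ∫⁻ s in Ioi (0 : ℝ), h s ∂ν₂ := by
    rw [hν₂, restrict_withDensity measurableSet_Ioi, Measure.restrict_restrict measurableSet_Ioi,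
      inter_self, lintegral_withDensity_eq_lintegral_mul₀ hv hm.aemeasurable]
    refine lintegral_congr fun s => ?_
    simp only [Pi.mul_apply]
    ring
  rw [e1, e2]
  -- Both sides are now integrals of `h` against measures, so it suffices to test on the intervals
  -- `(0, r)`, that is, on characteristic functions.
  refine lintegral_antitoneOn_le (fun r hr => ?_) hm hh
  have hkm : Measurable ((Iio r).indicator fun s : ℝ => ENNReal.ofReal (s ^ (q - 1))) :=
    hpm.indicator measurableSet_Iio
  have f2 : ν₂ (Ioo 0 r) = ∫⁻ s in Ioo 0 r, v s := by
    rw [hν₂, withDensity_apply _ measurableSet_Ioo, Measure.restrict_restrict measurableSet_Ioo,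
      inter_eq_self_of_subset_left Ioo_subset_Ioi_self]
  have f1 : ν₁ (Ioo 0 r) = ∫⁻ t in Ioi (0 : ℝ), (ENNReal.ofReal (t ^ (-q)) * v t) *
      ∫⁻ s in Ioo 0 t, (Iio r).indicator (fun s : ℝ => ENNReal.ofReal (s ^ (q - 1))) s := by
    rw [lintegral_mul_primitive hkm hu, hν₁, withDensity_apply _ measurableSet_Ioo,
      ← Ioi_inter_Iio, inter_comm, ← Measure.restrict_restrict measurableSet_Iio,
      ← lintegral_indicator measurableSet_Iio]
    refine lintegral_congr fun s => ?_
    by_cases hs : s ∈ Iio r <;> simp [indicator, hs, hΦ]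
  -- A crude bound for the integral of `s^(q-1)` up to `min t r`, without the factor `1 / q`. It is
  -- used with `m = t` for `t < r` and with `m = r` for `t ≥ r`.
  have hinner : ∀ t m : ℝ, 0 < m → (t ≤ m ∨ r ≤ m) → ∫⁻ s in Ioo 0 t,
      (Iio r).indicator (fun s : ℝ => ENNReal.ofReal (s ^ (q - 1))) s ≤
      ENNReal.ofReal (m ^ q) := by
    intro t m hm0 htm
    calc ∫⁻ s in Ioo 0 t, (Iio r).indicator (fun s : ℝ => ENNReal.ofReal (s ^ (q - 1))) s
        ≤ ∫⁻ s in Ioo 0 t, (Iio m).indicator (fun s : ℝ => ENNReal.ofReal (m ^ (q - 1))) s := by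
          refine setLIntegral_mono (measurable_const.indicator measurableSet_Iio) fun s hs => ?_
          by_cases hsr : s < r
          · have hsm : s < m := by
              rcases htm with h | h
              · exact hs.2.trans_le h
              · exact hsr.trans_le h
            simp only [indicator, mem_Iio, hsr, hsm, if_true]
            exact ENNReal.ofReal_le_ofReal
              (Real.rpow_le_rpow hs.1.le hsm.le (by linarith))
          · simp [indicator, hsr]
      _ ≤ ∫⁻ s in Ioo 0 m, ENNReal.ofReal (m ^ (q - 1)) := by
          rw [lintegral_indicator measurableSet_Iio, Measure.restrict_restrict measurableSet_Iio]
          exact lintegral_mono_set fun s hs => ⟨hs.2.1, hs.1⟩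
      _ = ENNReal.ofReal (m ^ q) := by
          simp only [lintegral_const, Measure.restrict_apply MeasurableSet.univ, univ_inter,
            Real.volume_Ioo, sub_zero]
          rw [← ENNReal.ofReal_mul (by positivity), ← Real.rpow_add_one hm0.ne']
          simp
  have hcancel : ∀ t : ℝ, 0 < t → ENNReal.ofReal (t ^ (-q)) * ENNReal.ofReal (t ^ q) = 1 := by
    intro t ht
    rw [← ENNReal.ofReal_mul (by positivity), ← Real.rpow_add ht]
    simp
  rw [f1, f2]
  calc _ ≤ ∫⁻ t in Ioo 0 r ∪ Ici r, (ENNReal.ofReal (t ^ (-q)) * v t) *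
        ∫⁻ s in Ioo 0 t, (Iio r).indicator (fun s : ℝ => ENNReal.ofReal (s ^ (q - 1))) s := by
        rw [Ioo_union_Ici_eq_Ioi hr]
    _ ≤ _ := lintegral_union_le _ _ _
    -- The part below `r` produces the `1` in `1 + C`; the part above `r` produces the `C`, through
    -- `hB`.
    _ ≤ (∫⁻ t in Ioo 0 r, v t) +
        ∫⁻ t in Ici r, ENNReal.ofReal (r ^ q) * (ENNReal.ofReal (t ^ (-q)) * v t) := by
        refine add_le_add (setLIntegral_mono' measurableSet_Ioo fun t ht => ?_)
          (lintegral_mono fun t => ?_)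
        · calc _ ≤ (ENNReal.ofReal (t ^ (-q)) * v t) * ENNReal.ofReal (t ^ q) := by
                gcongr
                exact hinner t t ht.1 (Or.inl le_rfl)
            _ = (ENNReal.ofReal (t ^ (-q)) * ENNReal.ofReal (t ^ q)) * v t := by ring
            _ = v t := by rw [hcancel t ht.1, one_mul]
        · rw [mul_comm]
          gcongr
          exact hinner t r hr (Or.inr le_rfl)
    _ = (∫⁻ t in Ioo 0 r, v t) + ENNReal.ofReal (r ^ q) *
          ∫⁻ t in Ioi r, (ENNReal.ofReal (t ^ (-q)) * v t) := by
        rw [lintegral_const_mul' _ _ ENNReal.ofReal_ne_top, setLIntegral_congr Ioi_ae_eq_Ici.symm]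
    _ ≤ (∫⁻ t in Ioo 0 r, v t) + ENNReal.ofReal (r ^ q) *
          (C * ENNReal.ofReal (r ^ (-q)) * ∫⁻ s in Ioo 0 r, v s) := by
        gcongr
        exact hB r hr
    _ = (∫⁻ t in Ioo 0 r, v t) + (ENNReal.ofReal (r ^ (-q)) * ENNReal.ofReal (r ^ q)) *
          C * ∫⁻ s in Ioo 0 r, v s := by ring
    _ = _ := by rw [hcancel r hr]; ring

/-- The chain rule `F ^ q = q ∫ F' F ^ (q - 1)` for the primitive `F` of a bounded decreasing
function. -/
lemma primitive_rpow_eq {q : ℝ} (hq : 1 < q) {g : ℝ → ℝ≥0∞} (hg : Antitone g)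
    (hfin : ∀ t, g t ≠ ∞) {t : ℝ} (ht : 0 ≤ t) :
    (∫⁻ s in Ioo 0 t, g s) ^ q =
      ENNReal.ofReal q * ∫⁻ s in Ioo 0 t, g s * (∫⁻ y in Ioo 0 s, g y) ^ (q - 1) := by
  set G : ℝ → ℝ := fun s => (g s).toReal with hG
  have hGanti : Antitone G := fun a b hab => ENNReal.toReal_mono (hfin a) (hg hab)
  have hGint : ∀ a b, IntervalIntegrable G volume a b := fun a b => hGanti.intervalIntegrable
  set F : ℝ → ℝ := fun s => ∫ y in (0 : ℝ)..s, G y with hF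
  have hFc : Continuous F := intervalIntegral.continuous_primitive hGint 0
  have hFnn : ∀ s, 0 ≤ s → 0 ≤ F s := fun s hs =>
    intervalIntegral.integral_nonneg hs fun y _ => ENNReal.toReal_nonneg
  have hFe : ∀ s, 0 ≤ s → ∫⁻ y in Ioo 0 s, g y = ENNReal.ofReal (F s) := by
    intro s hs
    rw [hF]
    simp only
    rw [intervalIntegral.integral_of_le hs, ofReal_integral_eq_lintegral_ofReal
      ((intervalIntegrable_iff_integrableOn_Ioc_of_le hs).1 (hGint 0 s))
      (Eventually.of_forall fun y => ENNReal.toReal_nonneg), setLIntegral_congr Ioo_ae_eq_Ioc]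
    exact lintegral_congr fun y => (ENNReal.ofReal_toReal (hfin y)).symm
  have hint : IntervalIntegrable (fun s => G s * F s ^ (q - 1) * q) volume 0 t := by
    refine IntervalIntegrable.mul_const ?_ q
    exact (hGint 0 t).mul_continuousOn
      (hFc.rpow_const fun x => Or.inr (by linarith)).continuousOn
  -- A monotone `G` has only countably many discontinuities; off them `F' = G`, and the fundamental
  -- theorem of calculus tolerates a countable exceptional set.
  have hderiv := integral_eq_of_hasDerivAt_off_countable_of_le (fun s => F s ^ q)
    (fun s => G s * F s ^ (q - 1) * q) ht hGanti.countable_not_continuousAt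
    (hFc.rpow_const fun x => Or.inr (by linarith)).continuousOn (fun s hs => by
      have hc : ContinuousAt G s := by
        by_contra h
        exact hs.2 h
      have h1 : HasDerivAt F (G s) s := intervalIntegral.integral_hasDerivAt_right (hGint 0 s)
        (hGanti.measurable.stronglyMeasurable.stronglyMeasurableAtFilter) hc
      have h2 := h1.rpow_const (p := q) (Or.inr hq.le)
      rw [mul_right_comm]
      exact h2) hint
  have hF0 : F 0 = 0 := by simp [hF]
  have key : ENNReal.ofReal (F t ^ q) =
      ∫⁻ s in Ioo 0 t, ENNReal.ofReal (G s * F s ^ (q - 1) * q) := by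
    have : F t ^ q = ∫ s in (0 : ℝ)..t, G s * F s ^ (q - 1) * q := by
      rw [hderiv]; simp only [hF0]; rw [Real.zero_rpow (by linarith), sub_zero]
    rw [this, intervalIntegral.integral_of_le ht, ofReal_integral_eq_lintegral_ofReal
      ((intervalIntegrable_iff_integrableOn_Ioc_of_le ht).1 hint), setLIntegral_congr Ioo_ae_eq_Ioc]
    refine (ae_restrict_iff' measurableSet_Ioc).2 (Eventually.of_forall fun s hs => ?_)
    have := hFnn s hs.1.le
    have h3 : 0 ≤ G s := ENNReal.toReal_nonneg
    simp only [Pi.zero_apply]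
    positivity
  rw [hFe t ht, ENNReal.ofReal_rpow_of_nonneg (hFnn t ht) (by linarith), key,
    ← lintegral_const_mul' _ _ ENNReal.ofReal_ne_top]
  refine setLIntegral_congr_fun measurableSet_Ioo fun s hs => ?_
  rw [hFe s hs.1.le, ENNReal.ofReal_rpow_of_nonneg (hFnn s hs.1.le) (by linarith),
    ENNReal.ofReal_mul' (by linarith), ENNReal.ofReal_mul ENNReal.toReal_nonneg,
    ENNReal.ofReal_toReal (hfin s)]
  ring

/-! ### Hardy's inequality for weights in `B_q` -/

section

lemma hardyOp_le_of_le {g : ℝ → ℝ≥0∞} {c : ℝ≥0∞} (hg : ∀ s, g s ≤ c) (t : ℝ) :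
    hardyOp g t ≤ c := by
  rcases le_or_gt t 0 with ht | ht
  · simp [hardyOp, ht]
  calc hardyOp g t ≤ (ENNReal.ofReal t)⁻¹ * ∫⁻ _ in Ioo 0 t, c := by
        unfold hardyOp
        gcongr
        exact hg _
    _ = (ENNReal.ofReal t)⁻¹ * ENNReal.ofReal t * c := by simp; ring
    _ = c := by rw [ENNReal.inv_mul_cancel (by simp [ht]) (by simp), one_mul]

lemma ofReal_mul_hardyOp (g : ℝ → ℝ≥0∞) {t : ℝ} (ht : 0 < t) :
    ENNReal.ofReal t * hardyOp g t = ∫⁻ s in Ioo 0 t, g s := by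
  unfold hardyOp
  rw [← mul_assoc, ENNReal.mul_inv_cancel (by simp [ht]) (by simp), one_mul]

section Hardy

variable {q : ℝ} {v : ℝ → ℝ≥0∞} {C : ℝ≥0∞}

/-- The case `α = 1` of Hardy's inequality: `primitive_rpow_eq` turns `(S g)^q` into `q t^(-q)`
times the integral over `(0, t)` of `s^(q-1) g (S g)^(q-1)`, and `g (S g)^(q-1)` is decreasing. -/
lemma lintegral_hardyOp_rpow_le (hq : 1 < q) (hv : AEMeasurable v (volume.restrict (Ioi 0)))
    (hB : ∀ r : ℝ, 0 < r → ∫⁻ s in Ioi r, ENNReal.ofReal (s ^ (-q)) * v s ≤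
      C * ENNReal.ofReal (r ^ (-q)) * ∫⁻ s in Ioo 0 r, v s)
    {g : ℝ → ℝ≥0∞} (hg : Antitone g) (hfin : ∀ t, g t ≠ ∞) :
    ∫⁻ t in Ioi (0 : ℝ), hardyOp g t ^ q * v t ≤
      ENNReal.ofReal q * (1 + C) * ∫⁻ t in Ioi (0 : ℝ), g t * hardyOp g t ^ (q - 1) * v t := by
  have hm : Measurable fun t => g t * hardyOp g t ^ (q - 1) :=
    hg.measurable.mul ((measurable_hardyOp g).pow_const _)
  have hh : AntitoneOn (fun t => g t * hardyOp g t ^ (q - 1)) (Ioi 0) := fun s hs t ht hst =>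
    mul_le_mul' (hg hst) (ENNReal.rpow_le_rpow (hardyOp_antitoneOn hg hs ht hst) (by linarith))
  calc ∫⁻ t in Ioi (0 : ℝ), hardyOp g t ^ q * v t
      = ∫⁻ t in Ioi (0 : ℝ), ENNReal.ofReal q * ((ENNReal.ofReal (t ^ (-q)) * v t) *
          ∫⁻ s in Ioo 0 t, g s * hardyOp g s ^ (q - 1) * ENNReal.ofReal (s ^ (q - 1))) := by
        refine setLIntegral_congr_fun measurableSet_Ioi fun t ht => ?_
        simp only [mem_Ioi] at ht
        have e1 : ∫⁻ s in Ioo 0 t, g s * (∫⁻ y in Ioo 0 s, g y) ^ (q - 1) =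
            ∫⁻ s in Ioo 0 t, g s * hardyOp g s ^ (q - 1) * ENNReal.ofReal (s ^ (q - 1)) := by
          refine setLIntegral_congr_fun measurableSet_Ioo fun s hs => ?_
          rw [← ofReal_mul_hardyOp g hs.1, ENNReal.mul_rpow_of_nonneg _ _ (by linarith),
            ENNReal.ofReal_rpow_of_nonneg hs.1.le (by linarith)]
          ring
        have e2 : hardyOp g t ^ q =
            ENNReal.ofReal (t ^ (-q)) * (∫⁻ s in Ioo 0 t, g s) ^ q := by
          rw [hardyOp, ENNReal.mul_rpow_of_nonneg _ _ (by linarith), ← ENNReal.ofReal_inv_of_pos ht,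
            ENNReal.ofReal_rpow_of_nonneg (by positivity) (by linarith), Real.rpow_neg ht.le,
            Real.inv_rpow ht.le]
        rw [e2, primitive_rpow_eq hq hg hfin ht.le, e1]
        ring
    _ = ENNReal.ofReal q * ∫⁻ t in Ioi (0 : ℝ), (ENNReal.ofReal (t ^ (-q)) * v t) *
          ∫⁻ s in Ioo 0 t, g s * hardyOp g s ^ (q - 1) * ENNReal.ofReal (s ^ (q - 1)) :=
        lintegral_const_mul' _ _ ENNReal.ofReal_ne_top
    _ ≤ ENNReal.ofReal q *
          ((1 + C) * ∫⁻ t in Ioi (0 : ℝ), g t * hardyOp g t ^ (q - 1) * v t) := by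
        gcongr
        exact lintegral_rpow_primitive_le hq hv hB hm hh
    _ = _ := by ring

/-- If `a ≤ δ b`, the last term suffices. Otherwise `b ≤ a / δ`, and replacing `b^(α-1)` by `(a /
δ)^(α-1)` gives the first term. -/
lemma mul_rpow_le_add {α : ℝ} (hα : 1 < α) (hαq : α ≤ q) {δ : ℝ≥0∞} (hδ0 : δ ≠ 0) (hδ : δ ≠ ∞)
    {a b : ℝ≥0∞} :
    a * b ^ (q - 1) ≤ δ ^ (1 - α) * (a ^ α * b ^ (q - α)) + δ * b ^ q := by
  rcases le_or_gt a (δ * b) with h | h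
  · calc a * b ^ (q - 1) ≤ δ * b * b ^ (q - 1) := by gcongr
      _ = δ * b ^ q := by
          rw [mul_assoc]
          nth_rewrite 1 [← ENNReal.rpow_one b]
          rw [← ENNReal.rpow_add_of_nonneg _ _ zero_le_one (by linarith)]
          simp
      _ ≤ _ := le_add_self
  · calc a * b ^ (q - 1) = a * (b ^ (α - 1) * b ^ (q - α)) := by
          rw [← ENNReal.rpow_add_of_nonneg _ _ (by linarith) (by linarith)]
          congr 2
          ring
      _ ≤ a * ((δ⁻¹ * a) ^ (α - 1) * b ^ (q - α)) := by
          have hb : b ≤ δ⁻¹ * a := by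
            rw [mul_comm, ← div_eq_mul_inv, ENNReal.le_div_iff_mul_le (Or.inl hδ0) (Or.inl hδ),
              mul_comm]
            exact h.le
          gcongr
      _ = δ ^ (1 - α) * ((a ^ (1 : ℝ) * a ^ (α - 1)) * b ^ (q - α)) := by
          rw [ENNReal.mul_rpow_of_nonneg _ _ (by linarith), ← ENNReal.rpow_neg_one δ,
            ← ENNReal.rpow_mul, ENNReal.rpow_one]
          rw [show -1 * (α - 1) = 1 - α by ring]
          ring
      _ = δ ^ (1 - α) * (a ^ α * b ^ (q - α)) := by
          rw [← ENNReal.rpow_add_of_nonneg _ _ zero_le_one (by linarith)]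
          simp
      _ ≤ _ := le_self_add

/-- The constant in Hardy's inequality for decreasing functions. -/
def hardyConst (q α : ℝ) (C : ℝ≥0∞) : ℝ≥0∞ :=
  2 * (ENNReal.ofReal q * (1 + C)) * (2 * (ENNReal.ofReal q * (1 + C)))⁻¹ ^ (1 - α)

lemma hardyConst_ne_top {α : ℝ} (hq : 1 < q) (hC : C ≠ ∞) : hardyConst q α C ≠ ∞ := by
  have h1 : 2 * (ENNReal.ofReal q * (1 + C)) ≠ ∞ := by finiteness
  have h2 : 2 * (ENNReal.ofReal q * (1 + C)) ≠ 0 := by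
    have : ¬ q ≤ 0 := by linarith
    simp [this]
  exact ENNReal.mul_ne_top h1 (ENNReal.rpow_ne_top_of_ne_zero (ENNReal.inv_ne_zero.2 h1)
    (ENNReal.inv_ne_top.2 h2))

/-- The splitting bounds `A` by a multiple of `B` plus `A / 2`; finiteness of `A` is what permits
the subtraction. -/
lemma lintegral_hardyOp_rpow_le_of_ne_top {α : ℝ} (hα : 1 < α) (hαq : α ≤ q) (hC : C ≠ ∞)
    (hv : AEMeasurable v (volume.restrict (Ioi 0)))
    (hB : ∀ r : ℝ, 0 < r → ∫⁻ s in Ioi r, ENNReal.ofReal (s ^ (-q)) * v s ≤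
      C * ENNReal.ofReal (r ^ (-q)) * ∫⁻ s in Ioo 0 r, v s)
    {g : ℝ → ℝ≥0∞} (hg : Antitone g) (hfin : ∀ t, g t ≠ ∞)
    (hA : ∫⁻ t in Ioi (0 : ℝ), hardyOp g t ^ q * v t ≠ ∞) :
    ∫⁻ t in Ioi (0 : ℝ), hardyOp g t ^ q * v t ≤
      hardyConst q α C * ∫⁻ t in Ioi (0 : ℝ), g t ^ α * hardyOp g t ^ (q - α) * v t := by
  have hq : 1 < q := by linarith
  set K := ENNReal.ofReal q * (1 + C) with hK
  have hK0 : K ≠ 0 := by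
    have : ¬ q ≤ 0 := by linarith
    simp [hK, this]
  have hKt : K ≠ ∞ := by finiteness
  -- Chosen so that `K δ = 1 / 2`.
  set δ := (2 * K)⁻¹ with hδ
  have hδ0 : δ ≠ 0 := ENNReal.inv_ne_zero.2 (by finiteness)
  have hδt : δ ≠ ∞ := ENNReal.inv_ne_top.2 (by simp [hK0])
  have hKδ : K * δ = 2⁻¹ := by
    rw [hδ, ENNReal.mul_inv (Or.inl two_ne_zero) (Or.inl ENNReal.ofNat_ne_top), mul_left_comm,
      ENNReal.mul_inv_cancel hK0 hKt, mul_one]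
  set A := ∫⁻ t in Ioi (0 : ℝ), hardyOp g t ^ q * v t with hAdef
  set B := ∫⁻ t in Ioi (0 : ℝ), g t ^ α * hardyOp g t ^ (q - α) * v t with hBdef
  have hδ1 : δ ^ (1 - α) ≠ ∞ := ENNReal.rpow_ne_top_of_ne_zero hδ0 hδt
  have h1 : A ≤ K * (δ ^ (1 - α) * B + δ * A) := by
    refine (lintegral_hardyOp_rpow_le hq hv hB hg hfin).trans ?_
    gcongr
    rw [hBdef, hAdef, ← lintegral_const_mul' _ _ hδ1, ← lintegral_const_mul' _ _ hδt,
      ← lintegral_add_left']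
    · refine lintegral_mono fun t => ?_
      calc g t * hardyOp g t ^ (q - 1) * v t
          ≤ (δ ^ (1 - α) * (g t ^ α * hardyOp g t ^ (q - α)) + δ * hardyOp g t ^ q) * v t := by
            gcongr
            exact mul_rpow_le_add hα hαq hδ0 hδt
        _ = _ := by ring
    · exact (((hg.measurable.pow_const α).mul
        ((measurable_hardyOp g).pow_const _)).aemeasurable.mul hv).const_mul _
  have h2 : A / 2 + A / 2 ≤ K * δ ^ (1 - α) * B + A / 2 := by
    rw [ENNReal.add_halves]
    refine h1.trans_eq ?_
    rw [mul_add, ← mul_assoc, ← mul_assoc, hKδ, div_eq_mul_inv, mul_comm 2⁻¹ A]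
  have h3 : A / 2 ≤ K * δ ^ (1 - α) * B :=
    (ENNReal.add_le_add_iff_right (ENNReal.div_ne_top hA two_ne_zero)).1 h2
  calc A = 2 * (A / 2) := (ENNReal.mul_div_cancel two_ne_zero ENNReal.ofNat_ne_top).symm
    _ ≤ 2 * (K * δ ^ (1 - α) * B) := by gcongr
    _ = hardyConst q α C * B := by rw [hardyConst, ← hK, ← hδ]; ring

/-- Hardy's inequality for decreasing functions and weights in `B_q`, in the form which bounds
`‖S g‖` by the functional that defines the space `Γ`. -/
theorem hardy_antitone {α : ℝ} (hα : 1 < α) (hαq : α ≤ q) (hC : C ≠ ∞)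
    (hv : AEMeasurable v (volume.restrict (Ioi 0)))
    (hW : ∀ r : ℝ, ∫⁻ s in Ioo 0 r, v s ≠ ∞)
    (hB : ∀ r : ℝ, 0 < r → ∫⁻ s in Ioi r, ENNReal.ofReal (s ^ (-q)) * v s ≤
      C * ENNReal.ofReal (r ^ (-q)) * ∫⁻ s in Ioo 0 r, v s)
    {g : ℝ → ℝ≥0∞} (hg : Antitone g) :
    ∫⁻ t in Ioi (0 : ℝ), hardyOp g t ^ q * v t ≤
      hardyConst q α C * ∫⁻ t in Ioi (0 : ℝ), g t ^ α * hardyOp g t ^ (q - α) * v t := by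
  have hq : 1 < q := by linarith
  -- Truncation in height and in support keeps monotonicity and makes the left side finite, as
  -- absorption requires; monotone convergence then recovers `g`.
  set u : ℕ → ℝ → ℝ≥0∞ := fun n t => if t < n then min (g t) n else 0 with hu
  have hanti : ∀ n, Antitone (u n) := by
    intro n s t hst
    by_cases ht : t < n
    · simp only [hu, ht, hst.trans_lt ht, if_true]
      exact min_le_min_right _ (hg hst)
    · simp [hu, ht]
  have hmono : ∀ t, Monotone fun n => u n t := by
    intro t m n hmn
    have hc : (m : ℝ) ≤ n := by exact_mod_cast hmn
    by_cases ht : t < m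
    · simp only [hu, ht, ht.trans_le hc, if_true]
      exact min_le_min_left _ (by exact_mod_cast hmn)
    · simp [hu, ht]
  have hle : ∀ n t, u n t ≤ n := by
    intro n t
    simp only [hu]
    split_ifs <;> simp
  have hug : ∀ n t, u n t ≤ g t := by
    intro n t
    simp only [hu]
    split_ifs <;> simp
  have hsup : ∀ t, ⨆ n, u n t = g t := by
    intro t
    refine le_antisymm (iSup_le fun n => hug n t) (le_of_forall_lt fun c hc => ?_)
    obtain ⟨m, hm⟩ := ENNReal.exists_nat_gt (hc.trans_le le_top).ne
    obtain ⟨k, hk⟩ := exists_nat_gt t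
    refine lt_of_lt_of_le ?_ (le_iSup (fun n => u n t) (max m k))
    have h1 : t < (max m k : ℕ) := hk.trans_le (by exact_mod_cast le_max_right m k)
    have h2 : c < (max m k : ℕ) := hm.trans_le (by exact_mod_cast le_max_left m k)
    simp only [hu, h1, if_true]
    exact lt_min hc h2
  have hSmono : ∀ t, Monotone fun n => hardyOp (u n) t := fun t m n hmn =>
    hardyOp_mono (fun s => hmono s hmn) t
  have hSsup : ∀ t, hardyOp g t = ⨆ n, hardyOp (u n) t := by
    intro t
    simp only [hardyOp]
    rw [← ENNReal.mul_iSup, ← lintegral_iSup (fun n => (hanti n).measurable)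
      (fun m n hmn s => hmono s hmn)]
    simp only [hsup]
  have hpow : ∀ t, hardyOp g t ^ q * v t = ⨆ n, hardyOp (u n) t ^ q * v t := by
    intro t
    rw [hSsup, ← ENNReal.iSup_mul]
    congr 1
    exact (ENNReal.orderIsoRpow q (by linarith)).map_iSup _
  simp only [hpow]
  rw [lintegral_iSup' (f := fun n t => hardyOp (u n) t ^ q * v t)
      (fun n => ((measurable_hardyOp _).pow_const q).aemeasurable.mul hv)
    (Eventually.of_forall fun t m n hmn =>
      mul_le_mul' (ENNReal.rpow_le_rpow (hSmono t hmn) (by linarith)) le_rfl)]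
  refine iSup_le fun n => ?_
  have hfin : ∀ t, u n t ≠ ∞ := fun t => ((hle n t).trans_lt (by simp)).ne
  refine (lintegral_hardyOp_rpow_le_of_ne_top hα hαq hC hv hB (hanti n) hfin ?_).trans ?_
  -- `S u_n` need not vanish beyond `n`, but the factor `u_n` in the case `α = 1` does, so that
  -- right side is at most a constant times `n^q W(n)`.
  · refine ((lintegral_hardyOp_rpow_le hq hv hB (hanti n) hfin).trans_lt ?_).ne
    refine ENNReal.mul_lt_top (by finiteness) ?_
    calc ∫⁻ t in Ioi (0 : ℝ), u n t * hardyOp (u n) t ^ (q - 1) * v t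
        ≤ ∫⁻ t in Ioi (0 : ℝ), (Iio (n : ℝ)).indicator
            (fun t => (n : ℝ≥0∞) * (n : ℝ≥0∞) ^ (q - 1) * v t) t := by
          refine lintegral_mono fun t => ?_
          by_cases ht : t < n
          · simp only [indicator, mem_Iio, ht, if_true]
            gcongr
            · exact hle n t
            · exact hardyOp_le_of_le (hle n) t
          · have h0 : u n t = 0 := by simp only [hu, ht, if_false]
            simp [h0]
      _ = (n : ℝ≥0∞) * (n : ℝ≥0∞) ^ (q - 1) * ∫⁻ t in Ioo 0 (n : ℝ), v t := by
          rw [lintegral_indicator measurableSet_Iio, Measure.restrict_restrict measurableSet_Iio,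
            inter_comm, Ioi_inter_Iio, lintegral_const_mul']
          exact ENNReal.mul_ne_top (by simp) (ENNReal.rpow_ne_top_of_nonneg (by linarith) (by simp))
      _ < ∞ := by
          refine ENNReal.mul_lt_top (ENNReal.mul_lt_top (by simp) ?_) (hW n).lt_top
          exact ENNReal.rpow_lt_top_of_nonneg (by linarith) (by simp)
  · gcongr with t
    · exact hug n t
    · exact hardyOp_mono (hug n) t

end Hardy

end

/-! ### The equivalent norm: triangle inequality, definiteness, limits -/

section

section Weight

variable {w : ℝ → ℝ}

lemma IsWeight.aemeasurable (hw : IsWeight w) :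
    AEMeasurable (fun t => ENNReal.ofReal (w t)) (volume.restrict (Ioi 0)) :=
  ((hw.locallyIntegrableOn.aestronglyMeasurable).aemeasurable.mono_measure
    (Measure.restrict_mono_set _ Ioi_subset_Ici_self)).ennreal_ofReal

lemma IsWeight.setLIntegral_ne_top (hw : IsWeight w) (r : ℝ) :
    ∫⁻ s in Ioo 0 r, ENNReal.ofReal (w s) ≠ ∞ := by
  have h1 : IntegrableOn w (Icc 0 r) :=
    hw.locallyIntegrableOn.integrableOn_compact_subset Icc_subset_Ici_self isCompact_Icc
  have h2 : IntegrableOn w (Ioo 0 r) := h1.mono_set Ioo_subset_Icc_self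
  exact h2.lintegral_lt_top.ne

lemma ofReal_div_rpow (q : ℝ) (a : ℝ) {s : ℝ} (hs : 0 < s) :
    ENNReal.ofReal (a / s ^ q) = ENNReal.ofReal (s ^ (-q)) * ENNReal.ofReal a := by
  rw [← ENNReal.ofReal_mul (by positivity), Real.rpow_neg hs.le, div_eq_mul_inv, mul_comm]

lemma IsBq.exists_const {q : ℝ} (h : IsBq q w) : ∃ C : ℝ≥0∞, C ≠ ∞ ∧
    ∀ r : ℝ, 0 < r → ∫⁻ s in Ioi r, ENNReal.ofReal (s ^ (-q)) * ENNReal.ofReal (w s) ≤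
      C * ENNReal.ofReal (r ^ (-q)) * ∫⁻ s in Ioo 0 r, ENNReal.ofReal (w s) := by
  obtain ⟨C, -, hB⟩ := h
  refine ⟨ENNReal.ofReal C, ENNReal.ofReal_ne_top, fun r hr => ?_⟩
  rw [mul_comm (ENNReal.ofReal C), ← ofReal_div_rpow q C hr]
  refine le_trans (le_of_eq ?_) (hB r hr)
  exact setLIntegral_congr_fun measurableSet_Ioi fun s hs =>
    (ofReal_div_rpow q (w s) (hr.trans hs)).symm

/-- If `w` vanished on `(0, r)`, then `B_q` would make it vanish on `(r, ∞)` too. Positivity near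
`0` gives definiteness of the norm and convergence of Cauchy sequences. -/
lemma IsWeight.setLIntegral_pos_of_isBq (hw : IsWeight w)
    (hw0 : ¬ (w =ᵐ[volume.restrict (Ioi 0)] 0)) {q : ℝ} (h : IsBq q w) {r : ℝ} (hr : 0 < r) :
    ∫⁻ s in Ioo 0 r, ENNReal.ofReal (w s) ≠ 0 := by
  intro h0
  apply hw0
  obtain ⟨C, -, hB⟩ := h.exists_const
  have h1 := hB r hr
  have hm : AEMeasurable (fun s => ENNReal.ofReal (s ^ (-q)) * ENNReal.ofReal (w s))
      (volume.restrict (Ioi r)) := AEMeasurable.mul (by fun_prop)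
    (hw.aemeasurable.mono_measure (Measure.restrict_mono_set _ (Ioi_subset_Ioi hr.le)))
  rw [h0, mul_zero, nonpos_iff_eq_zero, lintegral_eq_zero_iff' hm] at h1
  rw [lintegral_eq_zero_iff' (hw.aemeasurable.mono_measure
    (Measure.restrict_mono_set _ Ioo_subset_Ioi_self))] at h0
  have h0' := (ae_restrict_iff' measurableSet_Ioo).1 h0
  have h1' := (ae_restrict_iff' measurableSet_Ioi).1 h1
  refine (ae_restrict_iff' measurableSet_Ioi).2 ?_
  have hne : ∀ᵐ s : ℝ, s ≠ r := by simp [ae_iff]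
  filter_upwards [h0', h1', hne] with s hs0 hs1 hsr hs
  refine le_antisymm ?_ (hw.nonneg s hs)
  rcases lt_or_gt_of_ne hsr with hlt | hgt
  · exact ENNReal.ofReal_eq_zero.1 (hs0 ⟨hs, hlt⟩)
  · have h2 := hs1 hgt
    simp only [Pi.zero_apply, mul_eq_zero] at h2
    rcases h2 with h2 | h2
    · exact absurd h2 (by
        have : 0 < s ^ (-q) := Real.rpow_pos_of_pos hs _
        simpa using this)
    · exact ENNReal.ofReal_eq_zero.1 h2

end Weight

variable {Ω : Type*} [MeasurableSpace Ω] {μ : Measure Ω} {q : ℝ} {v : ℝ → ℝ≥0∞}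

/-- The functional `(∫_0^∞ f^{**}(t)^q v(t) dt)^(1/q)`. -/
def maximalNorm (μ : Measure Ω) (q : ℝ) (v : ℝ → ℝ≥0∞) (f : Ω → ℝ) : ℝ≥0∞ :=
  (∫⁻ t in Ioi (0 : ℝ), maximalFun μ f t ^ q * v t) ^ (1 / q)

lemma maximalNorm_congr_ae {f g : Ω → ℝ} (h : f =ᵐ[μ] g) :
    maximalNorm μ q v f = maximalNorm μ q v g := by
  simp only [maximalNorm, maximalFun_congr_ae h]

lemma gammaNorm_le_maximalNorm {α : ℝ} (hα : 1 < α) (hαq : α ≤ q) (w : ℝ → ℝ) (f : Ω → ℝ) :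
    gammaNorm μ q α w f ≤ maximalNorm μ q (fun t => ENNReal.ofReal (w t)) f := by
  unfold gammaNorm maximalNorm
  refine ENNReal.rpow_le_rpow (setLIntegral_mono' measurableSet_Ioi fun t ht => ?_)
    (by have := hα.trans_le hαq; positivity)
  gcongr
  calc decRearrangement μ f t ^ α * maximalFun μ f t ^ (q - α)
      ≤ maximalFun μ f t ^ α * maximalFun μ f t ^ (q - α) := by
        gcongr
        exact le_hardyOp (decRearrangement_antitone f) ht
    _ = maximalFun μ f t ^ q := by
        rw [← ENNReal.rpow_add_of_nonneg _ _ (by linarith) (by linarith)]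
        congr 1
        ring

lemma maximalNorm_le_gammaNorm {α : ℝ} (hα : 1 < α) (hαq : α ≤ q) {w : ℝ → ℝ} (hw : IsWeight w)
    (hB : IsBq q w) : ∃ K : ℝ≥0∞, K ≠ ∞ ∧ ∀ f : Ω → ℝ,
      maximalNorm μ q (fun t => ENNReal.ofReal (w t)) f ≤ K * gammaNorm μ q α w f := by
  obtain ⟨C, hC, hB⟩ := hB.exists_const
  have hq : 1 < q := hα.trans_le hαq
  have hq' : 0 ≤ 1 / q := by positivity
  refine ⟨hardyConst q α C ^ (1 / q),
    ENNReal.rpow_ne_top_of_nonneg hq' (hardyConst_ne_top hq hC), fun f => ?_⟩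
  unfold maximalNorm gammaNorm
  rw [← ENNReal.mul_rpow_of_nonneg _ _ hq']
  exact ENNReal.rpow_le_rpow (hardy_antitone hα hαq hC hw.aemeasurable hw.setLIntegral_ne_top hB
    (decRearrangement_antitone f)) hq'

lemma maximalNorm_add_le (hq : 1 < q) (hv : AEMeasurable v (volume.restrict (Ioi 0)))
    {f g : Ω → ℝ} (hf : AEMeasurable f μ) (hg : AEMeasurable g μ) :
    maximalNorm μ q v (f + g) ≤ maximalNorm μ q v f + maximalNorm μ q v g := by
  -- Moving `v^(1/q)` inside the power reduces the weighted triangle inequality to Minkowski for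
  -- Lebesgue measure.
  have key : ∀ h : Ω → ℝ, maximalNorm μ q v h =
      (∫⁻ t in Ioi (0 : ℝ), (maximalFun μ h t * v t ^ (1 / q)) ^ q) ^ (1 / q) := by
    intro h
    unfold maximalNorm
    congr 1
    refine lintegral_congr fun t => ?_
    rw [ENNReal.mul_rpow_of_nonneg _ _ (by linarith), ← ENNReal.rpow_mul,
      one_div_mul_cancel (by linarith), ENNReal.rpow_one]
  have hm : ∀ h : Ω → ℝ, AEMeasurable (fun t => maximalFun μ h t * v t ^ (1 / q))
      (volume.restrict (Ioi 0)) := fun h =>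
    (measurable_hardyOp _).aemeasurable.mul (hv.pow_const _)
  rw [key, key, key]
  refine le_trans ?_ (ENNReal.lintegral_Lp_add_le (hm f) (hm g) hq.le)
  refine ENNReal.rpow_le_rpow (lintegral_mono fun t => ?_) (by positivity)
  refine ENNReal.rpow_le_rpow ?_ (by linarith)
  simp only [Pi.add_apply]
  rw [← add_mul]
  gcongr
  exact maximalFun_add_le hf hg t

lemma maximalNorm_zero (hq : 1 < q) : maximalNorm μ q v (0 : Ω → ℝ) = 0 := by
  have h0 : ∀ t, decRearrangement μ (0 : Ω → ℝ) t = 0 := fun t => by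
    refine le_antisymm (decRearrangement_le_iff.2 ?_) zero_le
    simp
  have hq0 : 0 < q := by linarith
  simp [maximalNorm, maximalFun, hardyOp, h0, hq0]

lemma maximalNorm_smul (hq : 1 < q) (c : ℝ) (f : Ω → ℝ) :
    maximalNorm μ q v (c • f) = ENNReal.ofReal |c| * maximalNorm μ q v f := by
  rcases eq_or_ne c 0 with rfl | hc
  · simp [maximalNorm_zero hq]
  have hq0 : 0 < q := by linarith
  unfold maximalNorm
  simp only [maximalFun_smul c hc, ENNReal.mul_rpow_of_nonneg _ _ hq0.le, mul_assoc]
  rw [lintegral_const_mul' _ _ (ENNReal.rpow_ne_top_of_nonneg hq0.le ENNReal.ofReal_ne_top),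
    ENNReal.mul_rpow_of_nonneg _ _ (by positivity), ← ENNReal.rpow_mul,
    mul_one_div_cancel hq0.ne', ENNReal.rpow_one]

/-- Pointwise bound of the rearrangement by the norm. -/
lemma decRearrangement_mul_le_maximalNorm (hq : 1 < q) (f : Ω → ℝ) {t : ℝ} (ht : 0 < t) :
    decRearrangement μ f t * (∫⁻ s in Ioo 0 t, v s) ^ (1 / q) ≤ maximalNorm μ q v f := by
  have hq0 : 0 < q := by linarith
  have hanti := decRearrangement_antitone (μ := μ) f
  calc decRearrangement μ f t * (∫⁻ s in Ioo 0 t, v s) ^ (1 / q)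
      ≤ maximalFun μ f t * (∫⁻ s in Ioo 0 t, v s) ^ (1 / q) := by
        gcongr
        exact le_hardyOp hanti ht
    _ = (maximalFun μ f t ^ q * ∫⁻ s in Ioo 0 t, v s) ^ (1 / q) := by
        rw [ENNReal.mul_rpow_of_nonneg _ _ (by positivity), ← ENNReal.rpow_mul,
          mul_one_div_cancel hq0.ne', ENNReal.rpow_one]
    _ ≤ (∫⁻ s in Ioo 0 t, maximalFun μ f t ^ q * v s) ^ (1 / q) := by
        gcongr
        exact lintegral_const_mul_le _ _
    _ ≤ (∫⁻ s in Ioo 0 t, maximalFun μ f s ^ q * v s) ^ (1 / q) := by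
        refine ENNReal.rpow_le_rpow (setLIntegral_mono' measurableSet_Ioo fun s hs => ?_)
          (by positivity)
        gcongr
        exact hardyOp_antitoneOn hanti hs.1 ht hs.2.le
    _ ≤ _ := by
        unfold maximalNorm
        gcongr
        exact Ioo_subset_Ioi_self

lemma eq_zero_of_maximalNorm_eq_zero (hq : 1 < q)
    (hW : ∀ r : ℝ, 0 < r → ∫⁻ s in Ioo 0 r, v s ≠ 0) {f : Ω → ℝ}
    (h : maximalNorm μ q v f = 0) : f =ᵐ[μ] 0 := by
  refine eq_zero_of_decRearrangement_eq_zero fun t ht => ?_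
  have h1 := decRearrangement_mul_le_maximalNorm (μ := μ) (v := v) hq f ht
  rw [h, nonpos_iff_eq_zero, mul_eq_zero] at h1
  refine h1.resolve_right fun h2 => hW t ht ?_
  exact (ENNReal.rpow_eq_zero_iff_of_pos (by positivity)).1 h2

lemma maximalNorm_le_liminf (hq : 1 < q) (hv : AEMeasurable v (volume.restrict (Ioi 0)))
    {f : Ω → ℝ} {u : ℕ → Ω → ℝ}
    (h : ∀ᵐ x ∂μ, Tendsto (fun n => u n x) atTop (𝓝 (f x))) :
    maximalNorm μ q v f ≤ liminf (fun n => maximalNorm μ q v (u n)) atTop := by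
  have hq0 : 0 < q := by linarith
  have hliminf : ∀ (p : ℝ) (hp : 0 < p) (a : ℕ → ℝ≥0∞),
      (liminf a atTop) ^ p = liminf (fun n => a n ^ p) atTop := fun p hp a =>
    (ENNReal.orderIsoRpow p hp).liminf_apply
  unfold maximalNorm
  rw [← hliminf _ (by positivity)]
  gcongr
  calc ∫⁻ t in Ioi (0 : ℝ), maximalFun μ f t ^ q * v t
      ≤ ∫⁻ t in Ioi (0 : ℝ), liminf (fun n => maximalFun μ (u n) t ^ q * v t) atTop := by
        refine lintegral_mono fun t => ?_
        refine le_trans (mul_le_mul_left (ENNReal.rpow_le_rpow (maximalFun_le_liminf h t) hq0.le)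
          (v t)) ?_
        rw [hliminf q hq0]
        have h1 := ENNReal.le_liminf_mul (f := atTop) (u := fun n => maximalFun μ (u n) t ^ q)
          (v := fun _ => v t)
        rw [liminf_const] at h1
        exact h1
    _ ≤ _ := lintegral_liminf_le' fun n =>
        ((measurable_hardyOp _).pow_const q).aemeasurable.mul hv

/-- The radii that force a sequence which is Cauchy at this rate to converge almost everywhere. -/
def controlRadius (q : ℝ) (v : ℝ → ℝ≥0∞) (n : ℕ) : ℝ≥0∞ :=
  ENNReal.ofReal ((1 / 2) ^ n) * (∫⁻ s in Ioo 0 ((1 / 2 : ℝ) ^ n), v s) ^ (1 / q)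

/-- Borel–Cantelli gives an almost everywhere limit, and lower semicontinuity of the norm transfers
the Cauchy bounds to it. -/
lemma exists_limit_of_maximalNorm_lt (hq : 1 < q) (hv : AEMeasurable v (volume.restrict (Ioi 0)))
    (hW0 : ∀ r : ℝ, 0 < r → ∫⁻ s in Ioo 0 r, v s ≠ 0) (hW : ∀ r : ℝ, ∫⁻ s in Ioo 0 r, v s ≠ ∞)
    {u : ℕ → Ω → ℝ} (hu : ∀ n, AEMeasurable (u n) μ)
    (h : ∀ N n m, N ≤ n → N ≤ m → maximalNorm μ q v (u n - u m) < controlRadius q v N) :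
    ∃ g : Ω → ℝ, Measurable g ∧ ∀ n, maximalNorm μ q v (u n - g) ≤ controlRadius q v n := by
  -- The radius contains the factor `W(2^(-n))^(1/q)` so that it cancels in the pointwise bound at
  -- `t = 2^(-n)`, leaving `(u_n - u_{n+1})^*(2^(-n)) ≤ 2^(-n)`.
  have hstep : ∀ n, μ {x | ENNReal.ofReal ((1 / 2) ^ n) < ENNReal.ofReal |(u n - u (n + 1)) x|} ≤
      ENNReal.ofReal ((1 / 2) ^ n) := by
    intro n
    rw [← decRearrangement_le_iff]
    have hpos : (0 : ℝ) < (1 / 2) ^ n := by positivity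
    have h1 := (decRearrangement_mul_le_maximalNorm (μ := μ) (v := v) hq (u n - u (n + 1))
      hpos).trans (h n n (n + 1) le_rfl (Nat.le_succ n)).le
    have hw1 : (∫⁻ s in Ioo 0 ((1 / 2 : ℝ) ^ n), v s) ^ (1 / q) ≠ 0 := fun h2 =>
      hW0 _ hpos ((ENNReal.rpow_eq_zero_iff_of_pos (by positivity)).1 h2)
    have hw2 : (∫⁻ s in Ioo 0 ((1 / 2 : ℝ) ^ n), v s) ^ (1 / q) ≠ ∞ :=
      ENNReal.rpow_ne_top_of_nonneg (by positivity) (hW _)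
    exact (ENNReal.mul_le_mul_iff_left hw1 hw2).1 h1
  have hsum : ∑' n : ℕ, ENNReal.ofReal ((1 / 2 : ℝ) ^ n) ≠ ∞ := by
    rw [← ENNReal.ofReal_tsum_of_nonneg (fun n => by positivity) summable_geometric_two]
    exact ENNReal.ofReal_ne_top
  have hae : ∀ᵐ x ∂μ, ∃ l, Tendsto (fun n => u n x) atTop (𝓝 l) := by
    have hBC := ae_eventually_notMem (μ := μ)
      (s := fun n => {x | ENNReal.ofReal ((1 / 2) ^ n) < ENNReal.ofReal |(u n - u (n + 1)) x|})
      (ne_top_of_le_ne_top hsum (ENNReal.tsum_le_tsum hstep))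
    filter_upwards [hBC] with x hx
    obtain ⟨N, hN⟩ := eventually_atTop.1 hx
    have hc : CauchySeq fun n => u (n + N) x := by
      refine cauchySeq_of_le_geometric (1 / 2) 1 (by norm_num) fun n => ?_
      have h2 := hN (n + N) (Nat.le_add_left N n)
      simp only [not_lt, Pi.sub_apply] at h2
      rw [ENNReal.ofReal_le_ofReal_iff (by positivity)] at h2
      rw [Real.dist_eq, one_mul, add_right_comm]
      refine h2.trans ?_
      exact pow_le_pow_of_le_one (by norm_num) (by norm_num) (Nat.le_add_right n N)
    obtain ⟨l, hl⟩ := cauchySeq_tendsto_of_complete hc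
    exact ⟨l, (tendsto_add_atTop_iff_nat N).1 hl⟩
  obtain ⟨g, hg, hlim⟩ := measurable_limit_of_tendsto_metrizable_ae hu hae
  refine ⟨g, hg, fun n => ?_⟩
  have h3 : ∀ᵐ x ∂μ, Tendsto (fun m => (u n - u m) x) atTop (𝓝 ((u n - g) x)) := by
    filter_upwards [hlim] with x hx
    exact tendsto_const_nhds.sub hx
  refine (maximalNorm_le_liminf hq hv h3).trans ?_
  refine liminf_le_of_frequently_le (Eventually.frequently ?_) (by isBoundedDefault)
  filter_upwards [eventually_ge_atTop n] with m hm
  exact (h n n m le_rfl hm).le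

end

/-! ### Sufficiency of `B_q` -/

section

variable {Ω : Type*} [MeasurableSpace Ω] {μ : Measure Ω} {q : ℝ} {v : ℝ → ℝ≥0∞}

lemma controlRadius_ne_zero (hq : 1 < q) (hW0 : ∀ r : ℝ, 0 < r → ∫⁻ s in Ioo 0 r, v s ≠ 0)
    (n : ℕ) : controlRadius q v n ≠ 0 := by
  have hpos : (0 : ℝ) < (1 / 2) ^ n := by positivity
  refine mul_ne_zero (by simp) fun h2 => hW0 _ hpos ?_
  exact (ENNReal.rpow_eq_zero_iff_of_pos (by positivity)).1 h2

lemma controlRadius_ne_top (hq : 1 < q) (hW : ∀ r : ℝ, ∫⁻ s in Ioo 0 r, v s ≠ ∞) (n : ℕ) :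
    controlRadius q v n ≠ ∞ :=
  ENNReal.mul_ne_top ENNReal.ofReal_ne_top (ENNReal.rpow_ne_top_of_nonneg (by positivity) (hW _))

lemma tendsto_controlRadius (hq : 1 < q) (hW : ∀ r : ℝ, ∫⁻ s in Ioo 0 r, v s ≠ ∞) :
    Tendsto (controlRadius q v) atTop (𝓝 0) := by
  have hK : (∫⁻ s in Ioo 0 (1 : ℝ), v s) ^ (1 / q) ≠ ∞ :=
    ENNReal.rpow_ne_top_of_nonneg (by positivity) (hW 1)
  have h1 : Tendsto (fun n : ℕ => ENNReal.ofReal ((1 / 2) ^ n) *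
      (∫⁻ s in Ioo 0 (1 : ℝ), v s) ^ (1 / q)) atTop (𝓝 0) := by
    have h2 : Tendsto (fun n : ℕ => ENNReal.ofReal ((1 / 2) ^ n)) atTop (𝓝 0) := by
      simpa using ENNReal.tendsto_ofReal
        (tendsto_pow_atTop_nhds_zero_of_lt_one (r := (1 / 2 : ℝ)) (by norm_num) (by norm_num))
    simpa only [zero_mul] using ENNReal.Tendsto.mul_const h2 (Or.inr hK)
  refine tendsto_of_tendsto_of_tendsto_of_le_of_le tendsto_const_nhds h1 (fun n => zero_le)
    fun n => ?_
  unfold controlRadius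
  gcongr
  exact pow_le_one₀ (by norm_num) (by norm_num)

/-- If `w` is in `B_q`, the space `Γ^q_α(w)` is a Banach space, over any measure space. -/
theorem gammaIsBanach_of_isBq (μ : Measure Ω) {α : ℝ} (hα : 1 < α) (hαq : α ≤ q) {w : ℝ → ℝ}
    (hw : IsWeight w) (hw0 : ¬ (w =ᵐ[volume.restrict (Ioi 0)] 0)) (hB : IsBq q w) :
    GammaIsBanach μ q α w := by
  have hq : 1 < q := hα.trans_le hαq
  set v : ℝ → ℝ≥0∞ := fun t => ENNReal.ofReal (w t) with hv
  have hvm : AEMeasurable v (volume.restrict (Ioi 0)) := hw.aemeasurable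
  have hW : ∀ r : ℝ, ∫⁻ s in Ioo 0 r, v s ≠ ∞ := hw.setLIntegral_ne_top
  have hW0 : ∀ r : ℝ, 0 < r → ∫⁻ s in Ioo 0 r, v s ≠ 0 := fun r hr =>
    hw.setLIntegral_pos_of_isBq hw0 hB hr
  obtain ⟨K, hK, hNK⟩ := maximalNorm_le_gammaNorm (μ := μ) hα hαq hw hB
  have hNle : ∀ f : Ω → ℝ, gammaNorm μ q α w f ≤ maximalNorm μ q v f :=
    gammaNorm_le_maximalNorm hα hαq w
  -- By the two-sided comparison the space is the finiteness domain of a seminorm, hence a vector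
  -- space.
  have hmem : ∀ f : Ω →ₘ[μ] ℝ, f ∈ gammaSpace μ q α w ↔ maximalNorm μ q v f ≠ ∞ := fun f =>
    ⟨fun h => ((hNK f).trans_lt (ENNReal.mul_lt_top hK.lt_top h)).ne,
      fun h => (hNle f).trans_lt h.lt_top⟩
  have hadd : ∀ f g : Ω →ₘ[μ] ℝ, maximalNorm μ q v ((f + g : Ω →ₘ[μ] ℝ) : Ω → ℝ) ≤
      maximalNorm μ q v f + maximalNorm μ q v g := fun f g => by
    rw [maximalNorm_congr_ae (AEEqFun.coeFn_add f g)]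
    exact maximalNorm_add_le hq hvm f.aemeasurable g.aemeasurable
  have hsmul : ∀ (c : ℝ) (f : Ω →ₘ[μ] ℝ), maximalNorm μ q v ((c • f : Ω →ₘ[μ] ℝ) : Ω → ℝ) =
      ENNReal.ofReal |c| * maximalNorm μ q v f := fun c f => by
    rw [maximalNorm_congr_ae (AEEqFun.coeFn_smul c f), maximalNorm_smul hq]
  have hzero : maximalNorm μ q v ((0 : Ω →ₘ[μ] ℝ) : Ω → ℝ) = 0 := by
    rw [maximalNorm_congr_ae AEEqFun.coeFn_zero]
    exact maximalNorm_zero hq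
  let X : Submodule ℝ (Ω →ₘ[μ] ℝ) :=
    { carrier := gammaSpace μ q α w
      add_mem' := fun {f g} hf hg => by
        rw [hmem] at hf hg ⊢
        exact ne_top_of_le_ne_top (ENNReal.add_ne_top.2 ⟨hf, hg⟩) (hadd f g)
      zero_mem' := by
        rw [hmem, hzero]
        exact ENNReal.zero_ne_top
      smul_mem' := fun c f hf => by
        rw [hmem] at hf ⊢
        rw [hsmul]
        exact ENNReal.mul_ne_top ENNReal.ofReal_ne_top hf }
  have hX : ∀ f : X, maximalNorm μ q v ((f : Ω →ₘ[μ] ℝ) : Ω → ℝ) ≠ ∞ := fun f => (hmem f).1 f.2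
  let nX : Norm X := ⟨fun f => (maximalNorm μ q v ((f : Ω →ₘ[μ] ℝ) : Ω → ℝ)).toReal⟩
  have hnorm : ∀ f : X, ‖f‖ = (maximalNorm μ q v ((f : Ω →ₘ[μ] ℝ) : Ω → ℝ)).toReal := fun f => rfl
  have core : NormedSpace.Core ℝ X :=
    { norm_nonneg := fun f => ENNReal.toReal_nonneg
      norm_smul := fun c f => by
        rw [hnorm, hnorm, Submodule.coe_smul, hsmul, ENNReal.toReal_mul,
          ENNReal.toReal_ofReal (abs_nonneg c), Real.norm_eq_abs]
      norm_triangle := fun f g => by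
        rw [hnorm, hnorm, hnorm, ← ENNReal.toReal_add (hX f) (hX g), Submodule.coe_add]
        exact ENNReal.toReal_mono (ENNReal.add_ne_top.2 ⟨hX f, hX g⟩) (hadd _ _)
      norm_eq_zero_iff := fun f => by
        rw [hnorm, ENNReal.toReal_eq_zero_iff]
        constructor
        · intro h
          have h1 := eq_zero_of_maximalNorm_eq_zero hq hW0 (h.resolve_right (hX f))
          exact Subtype.ext (AEEqFun.ext (h1.trans AEEqFun.coeFn_zero.symm))
        · rintro rfl
          exact Or.inl hzero }
  refine ⟨X, rfl, nX, core, ?_, ?_⟩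
  · let _ := NormedAddCommGroup.ofCore core
    have hB0 : ∀ n, controlRadius q v n ≠ 0 := controlRadius_ne_zero hq hW0
    have hBt : ∀ n, controlRadius q v n ≠ ∞ := controlRadius_ne_top hq hW
    refine Metric.complete_of_convergent_controlled_sequences
      (fun n => (controlRadius q v n).toReal) (fun n => ENNReal.toReal_pos (hB0 n) (hBt n))
      fun u hu => ?_
    have hsub : ∀ n m, maximalNorm μ q v (((u n - u m : X) : Ω →ₘ[μ] ℝ) : Ω → ℝ) =
        maximalNorm μ q v ((u n : Ω →ₘ[μ] ℝ) - (u m : Ω →ₘ[μ] ℝ) : Ω → ℝ) := fun n m =>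
      maximalNorm_congr_ae (AEEqFun.coeFn_sub _ _)
    obtain ⟨g, hg, hlim⟩ := exists_limit_of_maximalNorm_lt (μ := μ) hq hvm hW0 hW
      (u := fun n => ((u n : Ω →ₘ[μ] ℝ) : Ω → ℝ)) (fun n => AEEqFun.aemeasurable _)
      (fun N n m hn hm => by
        have h1 := hu N n m hn hm
        rw [dist_eq_norm, hnorm, ENNReal.toReal_lt_toReal (hX _) (hBt N), hsub] at h1
        exact h1)
    set G : Ω →ₘ[μ] ℝ := AEEqFun.mk g hg.aestronglyMeasurable with hG
    have hGlim : ∀ n, maximalNorm μ q v (((u n : Ω →ₘ[μ] ℝ) - G : Ω →ₘ[μ] ℝ) : Ω → ℝ) ≤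
        controlRadius q v n := fun n => by
      refine le_trans (le_of_eq (maximalNorm_congr_ae ?_)) (hlim n)
      filter_upwards [AEEqFun.coeFn_sub (u n : Ω →ₘ[μ] ℝ) G,
        AEEqFun.coeFn_mk g hg.aestronglyMeasurable] with x hx hx2
      rw [hx, Pi.sub_apply, Pi.sub_apply, hG, hx2]
    have hGX : G ∈ X := by
      have h1 : (u 0 : Ω →ₘ[μ] ℝ) - G ∈ X := (hmem _).2 (ne_top_of_le_ne_top (hBt 0) (hGlim 0))
      have h2 := X.sub_mem (u 0).2 h1
      rwa [sub_sub_cancel] at h2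
    refine ⟨⟨G, hGX⟩, ?_⟩
    rw [tendsto_iff_norm_sub_tendsto_zero]
    have h3 : Tendsto (fun n => (controlRadius q v n).toReal) atTop (𝓝 0) := by
      simpa [Function.comp_def] using
        (ENNReal.tendsto_toReal ENNReal.zero_ne_top).comp (tendsto_controlRadius hq hW)
    refine squeeze_zero (fun n => norm_nonneg _) (fun n => ?_) h3
    exact ENNReal.toReal_mono (hBt n) (hGlim n)
  -- This exceeds both `K` and `1`, as the two bounds and the requirement on the constant demand.
  · refine ⟨K.toReal + 2, by linarith [ENNReal.toReal_nonneg (a := K)], fun f => ?_⟩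
    have hK0 : 0 ≤ K.toReal := ENNReal.toReal_nonneg
    have hγ : 0 ≤ (gammaNorm μ q α w ((f : Ω →ₘ[μ] ℝ) : Ω → ℝ)).toReal := ENNReal.toReal_nonneg
    constructor
    · have h1 : (gammaNorm μ q α w ((f : Ω →ₘ[μ] ℝ) : Ω → ℝ)).toReal ≤ ‖f‖ :=
        ENNReal.toReal_mono (hX f) (hNle _)
      exact (mul_le_of_le_one_left hγ (inv_le_one_of_one_le₀ (by linarith))).trans h1
    · have h1 : ‖f‖ ≤ K.toReal * (gammaNorm μ q α w ((f : Ω →ₘ[μ] ℝ) : Ω → ℝ)).toReal := by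
        rw [hnorm, ← ENNReal.toReal_mul]
        exact ENNReal.toReal_mono (ENNReal.mul_ne_top hK
          (ne_top_of_le_ne_top (hX f) (hNle _))) (hNK _)
      refine h1.trans ?_
      gcongr
      linarith

end

/-! ### Necessity: averaging the cyclic shifts of step functions -/

section

lemma coeFn_finset_sum {Ω ι : Type*} [MeasurableSpace Ω] {μ : Measure Ω} (s : Finset ι)
    (F : ι → Ω →ₘ[μ] ℝ) : ((∑ i ∈ s, F i : Ω →ₘ[μ] ℝ) : Ω → ℝ) =ᵐ[μ] ∑ i ∈ s, (F i : Ω → ℝ) := by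
  classical
  induction s using Finset.induction_on with
  | empty => simpa using AEEqFun.coeFn_zero
  | insert i s hi ih =>
    rw [Finset.sum_insert hi, Finset.sum_insert hi]
    exact (AEEqFun.coeFn_add _ _).trans (EventuallyEq.rfl.add ih)

section StepFun

variable {Ω ι : Type*} [Fintype ι] {E : ι → Set Ω}

/-- The step function with values `b j` on the sets `E j`. -/
def stepFun (E : ι → Set Ω) (b : ι → ℝ) (x : Ω) : ℝ :=
  ∑ j, (E j).indicator (fun _ => b j) x

lemma stepFun_of_mem (hd : Pairwise (Function.onFun Disjoint E)) (b : ι → ℝ) {x : Ω} {j : ι}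
    (hx : x ∈ E j) : stepFun E b x = b j := by
  unfold stepFun
  rw [Finset.sum_eq_single j, indicator_of_mem hx]
  · intro i _ hij
    exact indicator_of_notMem (fun hxi => (hd hij).le_bot ⟨hxi, hx⟩) _
  · simp

lemma stepFun_of_notMem (b : ι → ℝ) {x : Ω} (hx : ∀ j, x ∉ E j) : stepFun E b x = 0 :=
  Finset.sum_eq_zero fun j _ => indicator_of_notMem (hx j) _

/-- The cyclic shifts of a step function add up to a constant on the union of the cells. -/
lemma sum_stepFun_shift {M : ℕ} [NeZero M] (E : Fin M → Set Ω) (a : Fin M → ℝ) :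
    ∑ k : Fin M, stepFun E (fun j => a (j + k)) = stepFun E fun _ => ∑ j, a j := by
  funext x
  simp only [Finset.sum_apply, stepFun]
  rw [Finset.sum_comm]
  refine Finset.sum_congr rfl fun j _ => ?_
  by_cases hx : x ∈ E j
  · simp only [indicator_of_mem hx]
    exact Equiv.sum_comp (Equiv.addLeft j) a
  · simp [indicator_of_notMem hx]

end StepFun

variable {Ω : Type*} [MeasurableSpace Ω] {μ : Measure Ω} {q α : ℝ} {w : ℝ → ℝ}

/-- In a normable space the functional of a sum is controlled by the number of terms. -/
lemma GammaIsBanach.exists_sum_le (h : GammaIsBanach μ q α w) :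
    ∃ C : ℝ≥0∞, C ≠ ∞ ∧ ∀ (ι : Type) [Fintype ι] (f : ι → Ω → ℝ) (A : ℝ≥0∞), A ≠ ∞ →
      (∀ i, AEStronglyMeasurable (f i) μ) → (∀ i, gammaNorm μ q α w (f i) ≤ A) →
      gammaNorm μ q α w (∑ i, f i) ≤ C * (Fintype.card ι * A) := by
  obtain ⟨X, hX, nX, core, -, C, hC, hnorm⟩ := h
  let _ := NormedAddCommGroup.ofCore core
  -- One factor `C` is paid for passing to the norm and one for returning.
  refine ⟨ENNReal.ofReal (C * C), ENNReal.ofReal_ne_top, fun ι _ f A hA hf hfA => ?_⟩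
  have hco : ∀ i, gammaNorm μ q α w (AEEqFun.mk (f i) (hf i)) = gammaNorm μ q α w (f i) := fun i =>
    gammaNorm_congr_ae (AEEqFun.coeFn_mk _ _) _ _ _
  have hmem : ∀ i, AEEqFun.mk (f i) (hf i) ∈ X := fun i => by
    rw [← SetLike.mem_coe, hX]
    exact (hco i).trans_lt ((hfA i).trans_lt hA.lt_top)
  set F : ι → X := fun i => ⟨AEEqFun.mk (f i) (hf i), hmem i⟩ with hF
  have hsum : gammaNorm μ q α w ((∑ i, F i : X) : Ω →ₘ[μ] ℝ) = gammaNorm μ q α w (∑ i, f i) := by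
    refine gammaNorm_congr_ae ?_ _ _ _
    rw [Submodule.coe_sum]
    refine (coeFn_finset_sum _ _).trans ?_
    have : ∀ᵐ x ∂μ, ∀ i, (F i : Ω →ₘ[μ] ℝ) x = f i x :=
      eventually_all.2 fun i => AEEqFun.coeFn_mk _ (hf i)
    filter_upwards [this] with x hx
    simp only [Finset.sum_apply, hx]
  -- Closure of `X` under sums is needed here: the norm equivalence controls only `toReal`, which
  -- would be `0` at infinity.
  have hfin : gammaNorm μ q α w (∑ i, f i) ≠ ∞ := by
    rw [← hsum]
    have := (∑ i, F i).2
    rw [← SetLike.mem_coe, hX] at this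
    exact (show _ < ∞ from this).ne
  have hone : ∀ i, ‖F i‖ ≤ C * A.toReal := fun i => by
    refine (hnorm (F i)).2.trans ?_
    have h1 : (gammaNorm μ q α w ((F i : X) : Ω →ₘ[μ] ℝ)).toReal ≤ A.toReal :=
      ENNReal.toReal_mono hA ((hco i).trans_le (hfA i))
    gcongr
  have h2 : ‖∑ i, F i‖ ≤ Fintype.card ι * (C * A.toReal) := by
    refine (norm_sum_le _ _).trans ?_
    refine (Finset.sum_le_sum fun i _ => hone i).trans_eq ?_
    simp
  have h3 := (hnorm (∑ i, F i)).1
  rw [hsum, inv_mul_le_iff₀ (by linarith)] at h3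
  have h4 : (gammaNorm μ q α w (∑ i, f i)).toReal ≤ C * C * (Fintype.card ι * A.toReal) := by
    refine h3.trans ?_
    calc C * ‖∑ i, F i‖ ≤ C * (Fintype.card ι * (C * A.toReal)) := by gcongr
      _ = _ := by ring
  rw [← ENNReal.ofReal_toReal hfin]
  refine (ENNReal.ofReal_le_ofReal h4).trans_eq ?_
  rw [ENNReal.ofReal_mul (by positivity),
    ENNReal.ofReal_mul (p := (Fintype.card ι : ℝ)) (by positivity), ENNReal.ofReal_natCast,
    ENNReal.ofReal_toReal hA]

section Step

variable {ι : Type} [Fintype ι] {E : ι → Set Ω}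

lemma measurable_stepFun (hE : ∀ j, MeasurableSet (E j)) (b : ι → ℝ) :
    Measurable (stepFun E b) :=
  Finset.measurable_sum _ fun j _ => measurable_const.indicator (hE j)

lemma measure_lt_stepFun_le (hd : Pairwise (Function.onFun Disjoint E)) {m : ℝ≥0∞}
    (hm : ∀ j, μ (E j) = m) {b : ι → ℝ} (hb : ∀ j, 0 ≤ b j) (s : ℝ≥0∞) :
    μ {x | s < ENNReal.ofReal |stepFun E b x|} ≤
      (Finset.univ.filter fun j => s < ENNReal.ofReal (b j)).card * m := by
  classical
  calc μ {x | s < ENNReal.ofReal |stepFun E b x|}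
      ≤ μ (⋃ j ∈ Finset.univ.filter fun j => s < ENNReal.ofReal (b j), E j) := by
        refine measure_mono fun x hx => ?_
        have hx' : s < ENNReal.ofReal |stepFun E b x| := hx
        by_cases hmem : ∃ j, x ∈ E j
        · obtain ⟨j, hj⟩ := hmem
          rw [stepFun_of_mem hd b hj, abs_of_nonneg (hb j)] at hx'
          simp only [mem_iUnion]
          exact ⟨j, by simpa using hx', hj⟩
        · rw [stepFun_of_notMem b (not_exists.1 hmem)] at hx'
          simp at hx'
    _ ≤ ∑ j ∈ Finset.univ.filter fun j => s < ENNReal.ofReal (b j), μ (E j) :=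
        measure_biUnion_finset_le _ _
    _ = _ := by simp [hm]

lemma lintegral_stepFun (hE : ∀ j, MeasurableSet (E j)) {m : ℝ≥0∞}
    (hm : ∀ j, μ (E j) = m) {b : ι → ℝ} (hb : ∀ j, 0 ≤ b j) :
    ∫⁻ x, ENNReal.ofReal |stepFun E b x| ∂μ = ENNReal.ofReal (∑ j, b j) * m := by
  calc ∫⁻ x, ENNReal.ofReal |stepFun E b x| ∂μ
      = ∫⁻ x, ∑ j, (E j).indicator (fun _ => ENNReal.ofReal (b j)) x ∂μ := by
        refine lintegral_congr fun x => ?_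
        have h0 : ∀ j, 0 ≤ (E j).indicator (fun _ => b j) x := fun j =>
          indicator_nonneg (fun _ _ => hb j) x
        unfold stepFun
        rw [abs_of_nonneg (Finset.sum_nonneg fun j _ => h0 j),
          ENNReal.ofReal_sum_of_nonneg fun j _ => h0 j]
        refine Finset.sum_congr rfl fun j _ => ?_
        by_cases hx : x ∈ E j <;> simp [hx]
    _ = ENNReal.ofReal (∑ j, b j) * m := by
        rw [lintegral_finsetSum _ fun j _ => measurable_const.indicator (hE j),
          ENNReal.ofReal_sum_of_nonneg fun j _ => hb j, Finset.sum_mul]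
        refine Finset.sum_congr rfl fun j _ => ?_
        rw [lintegral_indicator_const (hE j), hm]

/-- A lower bound for the functional of a function which is constant on many cells. -/
lemma le_gammaNorm_stepFun (hα : 1 < α) (hαq : α ≤ q) (hE : ∀ j, MeasurableSet (E j))
    (hd : Pairwise (Function.onFun Disjoint E)) {r : ℝ}
    (hm : ∀ j, μ (E j) = ENNReal.ofReal r) {c : ℝ} (hc : 0 ≤ c) :
    ENNReal.ofReal c ^ q * ∫⁻ s in Ioo 0 (Fintype.card ι * r), ENNReal.ofReal (w s) ≤
      gammaNorm μ q α w (stepFun E fun _ => c) ^ q := by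
  have hq : 1 < q := hα.trans_le hαq
  have hanti := decRearrangement_antitone (μ := μ) (stepFun E fun _ => c)
  have hlow : ∀ t, 0 < t → t < Fintype.card ι * r →
      ENNReal.ofReal c ≤ decRearrangement μ (stepFun E fun _ => c) t := by
    intro t ht0 ht
    refine le_of_forall_lt fun s hs => ?_
    rw [lt_decRearrangement_iff]
    calc ENNReal.ofReal t < ENNReal.ofReal (Fintype.card ι * r) := by
          exact (ENNReal.ofReal_lt_ofReal_iff (ht0.trans ht)).2 ht
      _ = μ (⋃ j, E j) := by
          rw [measure_iUnion hd hE, tsum_fintype]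
          simp [hm, ENNReal.ofReal_mul]
      _ ≤ _ := measure_mono fun x hx => by
          obtain ⟨j, hj⟩ := mem_iUnion.1 hx
          change s < ENNReal.ofReal |stepFun E (fun _ => c) x|
          rwa [stepFun_of_mem hd _ hj, abs_of_nonneg hc]
  unfold gammaNorm
  rw [← ENNReal.rpow_mul, one_div_mul_cancel (by linarith), ENNReal.rpow_one,
    ← lintegral_const_mul' _ _ (ENNReal.rpow_ne_top_of_nonneg (by linarith) ENNReal.ofReal_ne_top)]
  refine (setLIntegral_mono' measurableSet_Ioo fun t ht => ?_).trans
    (lintegral_mono_set Ioo_subset_Ioi_self)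
  gcongr
  calc ENNReal.ofReal c ^ q = ENNReal.ofReal c ^ α * ENNReal.ofReal c ^ (q - α) := by
        rw [← ENNReal.rpow_add_of_nonneg _ _ (by linarith) (by linarith)]
        congr 1
        ring
    _ ≤ _ := by
        gcongr
        · exact hlow t ht.1 ht.2
        · exact (hlow t ht.1 ht.2).trans (le_hardyOp hanti ht.1)

/-- A measure space that contains sequences of disjoint sets of any prescribed measure. -/
def HasCells (μ : Measure Ω) : Prop :=
  ∀ r : ℝ, 0 < r → ∃ E : ℕ → Set Ω, (∀ j, MeasurableSet (E j)) ∧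
    Pairwise (Function.onFun Disjoint E) ∧ ∀ j, μ (E j) = ENNReal.ofReal r

/-- The averaging argument: a bound for the functional of all functions with the same distribution
as a step function bounds the average of its values. -/
lemma GammaIsBanach.exists_average_le (h : GammaIsBanach μ q α w) (hα : 1 < α) (hαq : α ≤ q)
    (hcells : HasCells μ) :
    ∃ D : ℝ≥0∞, D ≠ ∞ ∧ ∀ (M : ℕ) (r : ℝ) (a : Fin M → ℝ) (B : ℝ≥0∞), 0 < M → 0 < r →
      (∀ j, 0 ≤ a j) → B ≠ ∞ →
      (∀ f : Ω → ℝ, Measurable f → (∀ s, μ {x | s < ENNReal.ofReal |f x|} ≤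
        (Finset.univ.filter fun j => s < ENNReal.ofReal (a j)).card * ENNReal.ofReal r) →
        ∫⁻ x, ENNReal.ofReal |f x| ∂μ ≤ ENNReal.ofReal (∑ j, a j) * ENNReal.ofReal r →
        gammaNorm μ q α w f ^ q ≤ B) →
      ENNReal.ofReal (∑ j, a j) ^ q * ∫⁻ s in Ioo 0 (M * r), ENNReal.ofReal (w s) ≤
        D * (M : ℝ≥0∞) ^ q * B := by
  have hq : 1 < q := hα.trans_le hαq
  obtain ⟨C, hC, hsum⟩ := h.exists_sum_le
  refine ⟨C ^ q, ENNReal.rpow_ne_top_of_nonneg (by linarith) hC, ?_⟩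
  intro M r a B hM hr ha hB hbound
  obtain ⟨E, hE, hd, hm⟩ := hcells r hr
  have : NeZero M := ⟨hM.ne'⟩
  set E' : Fin M → Set Ω := fun j => E j with hE'
  have hd' : Pairwise (Function.onFun Disjoint E') := fun i j hij =>
    hd fun h => hij (Fin.ext h)
  have hE'm : ∀ j, MeasurableSet (E' j) := fun j => hE j
  have hm' : ∀ j, μ (E' j) = ENNReal.ofReal r := fun j => hm j
  -- Shifting permutes the values over cells of equal measure, so every shift satisfies the same
  -- distribution and integral bounds and `hbound` covers them all.
  have hk : ∀ k : Fin M, gammaNorm μ q α w (stepFun E' fun j => a (j + k)) ≤ B ^ (1 / q) := by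
    intro k
    have h1 := hbound (stepFun E' fun j => a (j + k)) (measurable_stepFun hE'm _)
      (fun s => by
        refine (measure_lt_stepFun_le hd' hm' (fun j => ha _) s).trans_eq ?_
        congr 2
        refine Finset.card_equiv (Equiv.addRight k) fun j => ?_
        simp)
      ((lintegral_stepFun hE'm hm' (fun j => ha _)).le.trans_eq (by
        congr 2
        exact Equiv.sum_comp (Equiv.addRight k) a))
    calc gammaNorm μ q α w (stepFun E' fun j => a (j + k))
        = (gammaNorm μ q α w (stepFun E' fun j => a (j + k)) ^ q) ^ (1 / q) := by
          rw [← ENNReal.rpow_mul, mul_one_div_cancel (by linarith), ENNReal.rpow_one]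
      _ ≤ B ^ (1 / q) := by gcongr
  have h2 := hsum (Fin M) (fun k => stepFun E' fun j => a (j + k)) (B ^ (1 / q))
    (ENNReal.rpow_ne_top_of_nonneg (by positivity) hB)
    (fun k => (measurable_stepFun hE'm _).aestronglyMeasurable) hk
  rw [sum_stepFun_shift] at h2
  have h3 := le_gammaNorm_stepFun (w := w) (c := ∑ j, a j) hα hαq hE'm hd' hm'
    (Finset.sum_nonneg fun j _ => ha j)
  rw [Fintype.card_fin] at h2 h3
  refine h3.trans ((ENNReal.rpow_le_rpow h2 (by linarith)).trans_eq ?_)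
  rw [ENNReal.mul_rpow_of_nonneg _ _ (by linarith), ENNReal.mul_rpow_of_nonneg _ _ (by linarith),
    ← ENNReal.rpow_mul, one_div_mul_cancel (by linarith), ENNReal.rpow_one, mul_assoc]

end Step

end

/-! ### Necessity: characteristic functions and harmonic step functions -/

section

variable {Ω : Type*} [MeasurableSpace Ω] {μ : Measure Ω} {q α : ℝ} {w : ℝ → ℝ}

/-- An upper bound for the functional in terms of bounds for `f^*` and `f^{**}`. -/
lemma gammaNorm_rpow_le (hα : 1 < α) (hαq : α ≤ q) {f : Ω → ℝ} {g : ℝ → ℝ≥0∞} {H : ℝ≥0∞}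
    {R : ℝ} (hH : H ≠ ∞) (h1 : ∀ t, 0 < t → t < R → decRearrangement μ f t ≤ g t)
    (h0 : ∀ t, R ≤ t → decRearrangement μ f t = 0)
    (h2 : ∀ t, 0 < t → t < R → maximalFun μ f t ≤ H * g t) :
    gammaNorm μ q α w f ^ q ≤
      H ^ (q - α) * ∫⁻ t in Ioo 0 R, g t ^ q * ENNReal.ofReal (w t) := by
  have hq : 1 < q := hα.trans_le hαq
  unfold gammaNorm
  rw [← ENNReal.rpow_mul, one_div_mul_cancel (by linarith), ENNReal.rpow_one,
    ← lintegral_const_mul' _ _ (ENNReal.rpow_ne_top_of_nonneg (by linarith) hH),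
    ← Ioi_inter_Iio, inter_comm, ← Measure.restrict_restrict measurableSet_Iio,
    ← lintegral_indicator measurableSet_Iio]
  refine setLIntegral_mono' measurableSet_Ioi fun t ht => ?_
  by_cases htR : t < R
  · simp only [indicator, mem_Iio, htR, if_true]
    calc decRearrangement μ f t ^ α * maximalFun μ f t ^ (q - α) * ENNReal.ofReal (w t)
        ≤ g t ^ α * (H * g t) ^ (q - α) * ENNReal.ofReal (w t) := by
          gcongr
          · exact h1 t ht htR
          · exact h2 t ht htR
      _ = H ^ (q - α) * (g t ^ α * g t ^ (q - α)) * ENNReal.ofReal (w t) := by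
          rw [ENNReal.mul_rpow_of_nonneg _ _ (by linarith)]
          ring
      _ = H ^ (q - α) * (g t ^ q * ENNReal.ofReal (w t)) := by
          rw [← ENNReal.rpow_add_of_nonneg _ _ (by linarith) (by linarith), add_sub_cancel,
            mul_assoc]
  · rw [h0 t (not_lt.1 htR), ENNReal.zero_rpow_of_pos (by linarith)]
    simp

lemma setLIntegral_decRearrangement_le_lintegral {f : Ω → ℝ} (hf : AEMeasurable f μ) {t : ℝ} :
    ∫⁻ s in Ioo 0 t, decRearrangement μ f s ≤ ∫⁻ x, ENNReal.ofReal |f x| ∂μ := by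
  simpa using setLIntegral_decRearrangement_le hf t 0

/-- The growth condition on the weight that is forced by characteristic functions. -/
lemma setLIntegral_weight_le (hα : 1 < α) (hαq : α ≤ q) (hw : IsWeight w) {D : ℝ≥0∞}
    (hD : ∀ (M : ℕ) (r : ℝ) (a : Fin M → ℝ) (B : ℝ≥0∞), 0 < M → 0 < r →
      (∀ j, 0 ≤ a j) → B ≠ ∞ →
      (∀ f : Ω → ℝ, Measurable f → (∀ s, μ {x | s < ENNReal.ofReal |f x|} ≤
        (Finset.univ.filter fun j => s < ENNReal.ofReal (a j)).card * ENNReal.ofReal r) →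
        ∫⁻ x, ENNReal.ofReal |f x| ∂μ ≤ ENNReal.ofReal (∑ j, a j) * ENNReal.ofReal r →
        gammaNorm μ q α w f ^ q ≤ B) →
      ENNReal.ofReal (∑ j, a j) ^ q * ∫⁻ s in Ioo 0 (M * r), ENNReal.ofReal (w s) ≤
        D * (M : ℝ≥0∞) ^ q * B) {M : ℕ} (hM : 0 < M) {r : ℝ} (hr : 0 < r) :
    ∫⁻ s in Ioo 0 (M * r), ENNReal.ofReal (w s) ≤
      D * (M : ℝ≥0∞) ^ q * ∫⁻ s in Ioo 0 r, ENNReal.ofReal (w s) := by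
  have : NeZero M := ⟨hM.ne'⟩
  -- One cell with value `1`: then `f^* ≤ 1`, and `f^* = 0` from `r` on, so `B` can be `W(r)`.
  have h := hD M r (Pi.single 0 1) (∫⁻ s in Ioo 0 r, ENNReal.ofReal (w s)) hM hr
    (fun j => by by_cases hj : j = 0 <;> simp [hj]) (hw.setLIntegral_ne_top r) ?_
  · simpa using h
  intro f _ hs _
  have hcard : ∀ s : ℝ≥0∞, (Finset.univ.filter fun j : Fin M =>
      s < ENNReal.ofReal ((Pi.single 0 1 : Fin M → ℝ) j)).card ≤ 1 := by
    intro s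
    refine Finset.card_le_one.2 fun i hi j hj => ?_
    have key : ∀ i : Fin M, s < ENNReal.ofReal ((Pi.single 0 1 : Fin M → ℝ) i) → i = 0 := by
      intro i hi
      by_contra h
      simp [h] at hi
    simp only [Finset.mem_filter, Finset.mem_univ, true_and] at hi hj
    rw [key i hi, key j hj]
  have hone : ∀ t, decRearrangement μ f t ≤ 1 := by
    intro t
    rw [decRearrangement_le_iff]
    refine (hs 1).trans ?_
    rw [Finset.filter_false_of_mem]
    · simp
    · intro j _
      by_cases hj : j = 0 <;> simp [hj]
  refine (gammaNorm_rpow_le (g := fun _ => 1) (H := 1) (R := r) hα hαq ENNReal.one_ne_top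
    (fun t _ _ => hone t) (fun t ht => ?_) (fun t _ _ => ?_)).trans (by simp)
  · refine le_antisymm (decRearrangement_le_iff.2 ((hs 0).trans ?_)) zero_le
    calc _ ≤ ((1 : ℕ) : ℝ≥0∞) * ENNReal.ofReal r := by gcongr; exact hcard 0
      _ ≤ ENNReal.ofReal t := by simpa using ENNReal.ofReal_le_ofReal ht
  · rw [one_mul]
    exact hardyOp_le_of_le hone t

/-- The logarithmic growth of the integral of `min 1 (r / t) ^ q` against the weight. -/
lemma lintegral_min_rpow_le (hq : 1 < q) {v : ℝ → ℝ≥0∞} {D : ℝ≥0∞} {r : ℝ} (hr : 0 < r)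
    (hD : ∀ M : ℕ, 0 < M → ∫⁻ s in Ioo 0 (M * r), v s ≤
      D * (M : ℝ≥0∞) ^ q * ∫⁻ s in Ioo 0 r, v s) (K : ℕ) :
    ∫⁻ t in Ioo 0 (2 ^ K * r), min 1 (ENNReal.ofReal (r / t)) ^ q * v t ≤
      (1 + K * (D * 2 ^ q)) * ∫⁻ s in Ioo 0 r, v s := by
  induction K with
  | zero =>
    simp only [pow_zero, one_mul, Nat.cast_zero, zero_mul, add_zero]
    refine lintegral_mono fun t => ?_
    calc _ ≤ (1 : ℝ≥0∞) ^ q * v t := by gcongr; exact min_le_left _ _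
      _ = v t := by simp
  | succ K ih =>
    have hpos : (0 : ℝ) < 2 ^ K * r := by positivity
    have hstep : ∫⁻ t in Ico (2 ^ K * r) (2 ^ (K + 1) * r),
        min 1 (ENNReal.ofReal (r / t)) ^ q * v t ≤ D * 2 ^ q * ∫⁻ s in Ioo 0 r, v s := by
      -- On the dyadic block the integrand gains `2^(-K q)` and `W` grows at most by `D 2^((K+1)
      -- q)`, so each block costs the same `D 2^q W(r)`.
      have h2 : ENNReal.ofReal ((1 / 2) ^ K) ^ q * ((2 ^ (K + 1) : ℕ) : ℝ≥0∞) ^ q = 2 ^ q := by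
        rw [← ENNReal.mul_rpow_of_nonneg _ _ (by linarith), ← ENNReal.ofReal_natCast,
          ← ENNReal.ofReal_mul (by positivity)]
        congr 1
        rw [Nat.cast_pow, pow_succ, ← mul_assoc, Nat.cast_ofNat, ← mul_pow]
        norm_num
      calc ∫⁻ t in Ico (2 ^ K * r) (2 ^ (K + 1) * r), min 1 (ENNReal.ofReal (r / t)) ^ q * v t
          ≤ ∫⁻ t in Ico (2 ^ K * r) (2 ^ (K + 1) * r), ENNReal.ofReal ((1 / 2) ^ K) ^ q * v t := by
            refine setLIntegral_mono' measurableSet_Ico fun t ht => ?_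
            gcongr
            refine (min_le_right _ _).trans (ENNReal.ofReal_le_ofReal ?_)
            rw [div_le_iff₀ (hpos.trans_le ht.1)]
            calc r = (1 / 2) ^ K * (2 ^ K * r) := by
                  rw [← mul_assoc, ← mul_pow]; norm_num
              _ ≤ _ := by gcongr; exact ht.1
        _ = ENNReal.ofReal ((1 / 2) ^ K) ^ q * ∫⁻ t in Ico (2 ^ K * r) (2 ^ (K + 1) * r), v t :=
            lintegral_const_mul' _ _ (ENNReal.rpow_ne_top_of_nonneg (by linarith)
              ENNReal.ofReal_ne_top)
        _ ≤ ENNReal.ofReal ((1 / 2) ^ K) ^ q * ∫⁻ t in Ioo 0 ((2 ^ (K + 1) : ℕ) * r), v t := by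
            gcongr
            intro t ht
            exact ⟨hpos.trans_le ht.1, by push_cast; exact ht.2⟩
        _ ≤ ENNReal.ofReal ((1 / 2) ^ K) ^ q * (D * ((2 ^ (K + 1) : ℕ) : ℝ≥0∞) ^ q *
              ∫⁻ s in Ioo 0 r, v s) := by
            gcongr
            exact hD _ (by positivity)
        _ = D * (ENNReal.ofReal ((1 / 2) ^ K) ^ q * ((2 ^ (K + 1) : ℕ) : ℝ≥0∞) ^ q) *
              ∫⁻ s in Ioo 0 r, v s := by ring
        _ = _ := by rw [h2]
    calc _ ≤ ∫⁻ t in Ioo 0 (2 ^ K * r) ∪ Ico (2 ^ K * r) (2 ^ (K + 1) * r),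
          min 1 (ENNReal.ofReal (r / t)) ^ q * v t := by
          refine lintegral_mono_set fun t ht => ?_
          rcases lt_or_ge t (2 ^ K * r) with h | h
          · exact Or.inl ⟨ht.1, h⟩
          · exact Or.inr ⟨h, ht.2⟩
      _ ≤ _ := lintegral_union_le _ _ _
      _ ≤ (1 + K * (D * 2 ^ q)) * (∫⁻ s in Ioo 0 r, v s) + D * 2 ^ q * ∫⁻ s in Ioo 0 r, v s :=
          add_le_add ih hstep
      _ = _ := by push_cast; ring

/-- The number of terms of the harmonic sequence above a level. -/
lemma card_inv_gt_le (M : ℕ) {x : ℝ} (hx : 0 < x) :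
    ((Finset.univ.filter fun j : Fin M => ENNReal.ofReal x⁻¹ <
      ENNReal.ofReal ((j : ℝ) + 1)⁻¹).card : ℝ) ≤ x := by
  have hcard : (Finset.univ.filter fun j : Fin M => ENNReal.ofReal x⁻¹ <
      ENNReal.ofReal ((j : ℝ) + 1)⁻¹).card ≤ (Finset.range ⌊x⌋₊).card := by
    refine Finset.card_le_card_of_injOn (fun j => (j : ℕ)) (fun j hj => ?_)
      (fun i _ j _ h => Fin.ext h)
    simp only [Finset.coe_filter, Finset.mem_univ, true_and, mem_ofPred_eq] at hj
    rw [ENNReal.ofReal_lt_ofReal_iff (by positivity), inv_lt_inv₀ hx (by positivity)] at hj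
    simp only [Finset.coe_range, mem_Iio]
    rw [← Nat.add_one_le_iff, Nat.le_floor_iff hx.le]
    push_cast
    exact hj.le
  rw [Finset.card_range] at hcard
  exact (Nat.cast_le.2 hcard).trans (Nat.floor_le hx.le)

/-- The consequence of normability for the weight that is seen by the function `min 1 (r / t)`. -/
lemma harmonic_rpow_mul_weight_le (hα : 1 < α) (hαq : α ≤ q) (hw : IsWeight w) {D : ℝ≥0∞}
    (hDt : D ≠ ∞)
    (hD : ∀ (M : ℕ) (r : ℝ) (a : Fin M → ℝ) (B : ℝ≥0∞), 0 < M → 0 < r →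
      (∀ j, 0 ≤ a j) → B ≠ ∞ →
      (∀ f : Ω → ℝ, Measurable f → (∀ s, μ {x | s < ENNReal.ofReal |f x|} ≤
        (Finset.univ.filter fun j => s < ENNReal.ofReal (a j)).card * ENNReal.ofReal r) →
        ∫⁻ x, ENNReal.ofReal |f x| ∂μ ≤ ENNReal.ofReal (∑ j, a j) * ENNReal.ofReal r →
        gammaNorm μ q α w f ^ q ≤ B) →
      ENNReal.ofReal (∑ j, a j) ^ q * ∫⁻ s in Ioo 0 (M * r), ENNReal.ofReal (w s) ≤
        D * (M : ℝ≥0∞) ^ q * B) (K : ℕ) {r : ℝ} (hr : 0 < r) :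
    ENNReal.ofReal (∑ j : Fin (2 ^ K), ((j : ℝ) + 1)⁻¹) ^ α *
      ∫⁻ s in Ioo 0 (2 ^ K * r), ENNReal.ofReal (w s) ≤
      D * (1 + K * (D * 2 ^ q)) * ((2 : ℝ≥0∞) ^ K) ^ q *
        ∫⁻ s in Ioo 0 r, ENNReal.ofReal (w s) := by
  have hq : 1 < q := hα.trans_le hαq
  set M : ℕ := 2 ^ K with hM
  have hM0 : 0 < M := by positivity
  have hMc : (M : ℝ) = 2 ^ K := by simp [hM]
  set a : Fin M → ℝ := fun j => ((j : ℝ) + 1)⁻¹ with ha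
  have ha0 : ∀ j, 0 ≤ a j := fun j => by positivity
  set H := ENNReal.ofReal (∑ j, a j) with hH
  have hH1 : 1 ≤ H := by
    rw [hH, ENNReal.one_le_ofReal]
    refine le_trans ?_ (Finset.single_le_sum (fun j _ => ha0 j) (Finset.mem_univ ⟨0, hM0⟩))
    simp [ha]
  have hHt : H ≠ ∞ := ENNReal.ofReal_ne_top
  set I := ∫⁻ s in Ioo 0 r, ENNReal.ofReal (w s) with hI
  have hIt : I ≠ ∞ := hw.setLIntegral_ne_top r
  have hgrow := lintegral_min_rpow_le hq hr (v := fun s => ENNReal.ofReal (w s))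
    (fun M hM => setLIntegral_weight_le hα hαq hw hD hM hr) K
  have hfin : (1 + (K : ℝ≥0∞) * (D * 2 ^ q)) ≠ ∞ := by
    have : (2 : ℝ≥0∞) ^ q ≠ ∞ := ENNReal.rpow_ne_top_of_nonneg (by linarith) (by simp)
    finiteness
  have hHp : H ^ (q - α) ≠ ∞ := ENNReal.rpow_ne_top_of_nonneg (by linarith) hHt
  have hHp0 : H ^ (q - α) ≠ 0 := by
    have : H ≠ 0 := (zero_lt_one.trans_le hH1).ne'
    simp [ENNReal.rpow_eq_zero_iff, this, hHt]
  -- The bound `B` carries `H^(q-α)` because only the factor `(f^{**})^(q-α)` pays for the harmonic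
  -- sum. Cancelling it against `H^q` leaves `H^α`.
  have key := hD M r a (H ^ (q - α) * ((1 + K * (D * 2 ^ q)) * I)) hM0 hr ha0
    (ENNReal.mul_ne_top hHp (ENNReal.mul_ne_top hfin hIt)) ?_
  · rw [hMc, ← hH] at key
    have h1 : H ^ (q - α) * (H ^ α * ∫⁻ s in Ioo 0 (2 ^ K * r), ENNReal.ofReal (w s)) ≤
        H ^ (q - α) * (D * (1 + K * (D * 2 ^ q)) * ((2 : ℝ≥0∞) ^ K) ^ q * I) := by
      calc _ = H ^ q * ∫⁻ s in Ioo 0 (2 ^ K * r), ENNReal.ofReal (w s) := by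
            rw [← mul_assoc, ← ENNReal.rpow_add_of_nonneg _ _ (by linarith) (by linarith),
              sub_add_cancel]
        _ ≤ _ := key
        _ = _ := by rw [hM]; push_cast; ring
    exact (ENNReal.mul_le_mul_iff_right hHp0 hHp).1 h1
  intro f hf hs hint
  have hone : ∀ t, decRearrangement μ f t ≤ 1 := by
    intro t
    rw [decRearrangement_le_iff]
    refine (hs 1).trans ?_
    rw [Finset.filter_false_of_mem]
    · simp
    · intro j _
      rw [not_lt]
      refine ENNReal.ofReal_le_one.2 (inv_le_one_of_one_le₀ ?_)
      have : (0 : ℝ) ≤ (j : ℕ) := Nat.cast_nonneg _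
      linarith
  have hdiv : ∀ t, 0 < t → decRearrangement μ f t ≤ ENNReal.ofReal (r / t) := by
    intro t ht
    rw [decRearrangement_le_iff]
    refine (hs _).trans ?_
    -- At most `t / r` of the values exceed `r / t`, and their cells have total measure at most `t`.
    have h1 := card_inv_gt_le M (x := t / r) (by positivity)
    rw [inv_div] at h1
    rw [← ENNReal.ofReal_natCast, ← ENNReal.ofReal_mul (by positivity)]
    refine ENNReal.ofReal_le_ofReal ?_
    rwa [← le_div_iff₀ hr]
  refine (gammaNorm_rpow_le (g := fun t => min 1 (ENNReal.ofReal (r / t))) (H := H)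
    (R := 2 ^ K * r) hα hαq hHt (fun t ht _ => le_min (hone t) (hdiv t ht)) (fun t ht => ?_)
    (fun t ht _ => ?_)).trans (by gcongr)
  · refine le_antisymm (decRearrangement_le_iff.2 ((hs 0).trans ?_)) zero_le
    calc _ ≤ ((M : ℕ) : ℝ≥0∞) * ENNReal.ofReal r := by
          gcongr
          exact (Finset.card_filter_le _ _).trans (by simp)
      _ ≤ ENNReal.ofReal t := by
          rw [← ENNReal.ofReal_natCast, ← ENNReal.ofReal_mul (by positivity), hMc]
          exact ENNReal.ofReal_le_ofReal ht
  · rw [mul_min, mul_one]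
    -- `f^{**} ≤ 1 ≤ H` gives one bound; `t f^{**}(t) ≤ ∫ |f| ≤ H r` gives the other.
    refine le_min ((hardyOp_le_of_le hone t).trans hH1) ?_
    calc maximalFun μ f t = (ENNReal.ofReal t)⁻¹ * ∫⁻ s in Ioo 0 t, decRearrangement μ f s := rfl
      _ ≤ (ENNReal.ofReal t)⁻¹ * (H * ENNReal.ofReal r) := by
          gcongr
          exact (setLIntegral_decRearrangement_le_lintegral hf.aemeasurable).trans hint
      _ = H * ENNReal.ofReal (r / t) := by
          rw [ENNReal.ofReal_div_of_pos ht, div_eq_mul_inv]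
          ring

end

/-! ### Necessity: from the growth of the primitive to `B_q` -/

/-- A weight whose primitive grows geometrically slower than `r ^ q` is in `B_q`. -/
lemma isBq_of_two_mul_le {q : ℝ} (hq : 1 < q) {w : ℝ → ℝ} {l : ℝ} (hl : 1 < l)
    (h : ∀ r : ℝ, 0 < r → 2 * ∫⁻ s in Ioo 0 (l * r), ENNReal.ofReal (w s) ≤
      ENNReal.ofReal (l ^ q) * ∫⁻ s in Ioo 0 r, ENNReal.ofReal (w s)) : IsBq q w := by
  have hl0 : 0 < l := by linarith
  -- On each block `s^(-q)` is taken at the left end and `W` at the right end, which costs `l^q`;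
  -- the `2` is the sum of the geometric series.
  refine ⟨2 * l ^ q, by positivity, fun r hr => ?_⟩
  set I := ∫⁻ s in Ioo 0 r, ENNReal.ofReal (w s) with hI
  have hiter : ∀ m : ℕ, ∫⁻ s in Ioo 0 (l ^ m * r), ENNReal.ofReal (w s) ≤
      2⁻¹ ^ m * (ENNReal.ofReal ((l ^ m) ^ q) * I) := by
    intro m
    induction m with
    | zero => simp [hI]
    | succ m ih =>
      have h1 := h (l ^ m * r) (by positivity)
      rw [← mul_assoc, ← pow_succ'] at h1
      calc ∫⁻ s in Ioo 0 (l ^ (m + 1) * r), ENNReal.ofReal (w s)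
          = 2⁻¹ * (2 * ∫⁻ s in Ioo 0 (l ^ (m + 1) * r), ENNReal.ofReal (w s)) := by
            rw [← mul_assoc, ENNReal.inv_mul_cancel two_ne_zero ENNReal.ofNat_ne_top, one_mul]
        _ ≤ 2⁻¹ * (ENNReal.ofReal (l ^ q) * (2⁻¹ ^ m * (ENNReal.ofReal ((l ^ m) ^ q) * I))) := by
            exact mul_le_mul_right (h1.trans (by gcongr)) _
        _ = 2⁻¹ ^ (m + 1) * (ENNReal.ofReal (l ^ q) * ENNReal.ofReal ((l ^ m) ^ q) * I) := by ring
        _ = _ := by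
            rw [← ENNReal.ofReal_mul (by positivity), ← Real.mul_rpow (by positivity)
              (by positivity), ← pow_succ']
  have hpiece : ∀ m : ℕ, ∫⁻ s in Ico (l ^ m * r) (l ^ (m + 1) * r), ENNReal.ofReal (w s / s ^ q) ≤
      2⁻¹ ^ m * (ENNReal.ofReal (l ^ q / r ^ q) * I) := by
    intro m
    have hpos : 0 < l ^ m * r := by positivity
    calc ∫⁻ s in Ico (l ^ m * r) (l ^ (m + 1) * r), ENNReal.ofReal (w s / s ^ q)
        ≤ ∫⁻ s in Ico (l ^ m * r) (l ^ (m + 1) * r),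
            ENNReal.ofReal ((l ^ m * r) ^ (-q)) * ENNReal.ofReal (w s) := by
          refine setLIntegral_mono' measurableSet_Ico fun s hs => ?_
          rw [ofReal_div_rpow q _ (hpos.trans_le hs.1)]
          refine mul_le_mul_left (ENNReal.ofReal_le_ofReal ?_) _
          exact Real.rpow_le_rpow_of_nonpos hpos hs.1 (by linarith)
      _ = ENNReal.ofReal ((l ^ m * r) ^ (-q)) *
            ∫⁻ s in Ico (l ^ m * r) (l ^ (m + 1) * r), ENNReal.ofReal (w s) :=
          lintegral_const_mul' _ _ ENNReal.ofReal_ne_top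
      _ ≤ ENNReal.ofReal ((l ^ m * r) ^ (-q)) *
            (2⁻¹ ^ (m + 1) * (ENNReal.ofReal ((l ^ (m + 1)) ^ q) * I)) := by
          gcongr
          refine (lintegral_mono_set fun s hs => ?_).trans (hiter (m + 1))
          exact ⟨hpos.trans_le hs.1, hs.2⟩
      _ = 2⁻¹ ^ (m + 1) * ((ENNReal.ofReal ((l ^ m * r) ^ (-q)) *
            ENNReal.ofReal ((l ^ (m + 1)) ^ q)) * I) := by ring
      _ = 2⁻¹ ^ (m + 1) * (ENNReal.ofReal (l ^ q / r ^ q) * I) := by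
          have e : (l ^ m * r) ^ (-q) * (l ^ (m + 1)) ^ q = l ^ q / r ^ q := by
            rw [Real.rpow_neg hpos.le, pow_succ, Real.mul_rpow (by positivity) hr.le,
              Real.mul_rpow (by positivity) hl0.le]
            have h1 : (l ^ m) ^ q ≠ 0 := (Real.rpow_pos_of_pos (by positivity) q).ne'
            have h2 : r ^ q ≠ 0 := (Real.rpow_pos_of_pos hr q).ne'
            field_simp
          rw [← ENNReal.ofReal_mul (by positivity), e]
      _ ≤ _ := by
          gcongr ?_ * _
          exact pow_le_pow_right_of_le_one' (by simp) (Nat.le_succ m)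
  calc ∫⁻ s in Ioi r, ENNReal.ofReal (w s / s ^ q)
      ≤ ∫⁻ s in ⋃ m : ℕ, Ico (l ^ m * r) (l ^ (m + 1) * r), ENNReal.ofReal (w s / s ^ q) := by
        refine lintegral_mono_set fun s hs => ?_
        obtain ⟨m, hm1, hm2⟩ := exists_nat_pow_near (x := s / r) (y := l)
          ((one_le_div hr).2 (le_of_lt hs)) hl
        exact mem_iUnion.2 ⟨m, (le_div_iff₀ hr).1 hm1, (div_lt_iff₀ hr).1 hm2⟩
    _ ≤ ∑' m : ℕ, ∫⁻ s in Ico (l ^ m * r) (l ^ (m + 1) * r), ENNReal.ofReal (w s / s ^ q) :=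
        lintegral_iUnion_le _ _
    _ ≤ ∑' m : ℕ, 2⁻¹ ^ m * (ENNReal.ofReal (l ^ q / r ^ q) * I) := ENNReal.tsum_le_tsum hpiece
    _ = 2 * (ENNReal.ofReal (l ^ q / r ^ q) * I) := by
        rw [ENNReal.tsum_mul_right]
        congr 1
        rw [ENNReal.tsum_geometric, ENNReal.one_sub_inv_two, inv_inv]
    _ = ENNReal.ofReal (2 * l ^ q / r ^ q) * I := by
        rw [mul_div_assoc, ENNReal.ofReal_mul zero_le_two, mul_assoc]
        simp

lemma mul_log_two_le_sum_inv (K : ℕ) :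
    K * Real.log 2 ≤ ∑ j : Fin (2 ^ K), ((j : ℝ) + 1)⁻¹ := by
  have h := log_add_one_le_harmonic (2 ^ K)
  have e : ((harmonic (2 ^ K) : ℚ) : ℝ) = ∑ j : Fin (2 ^ K), ((j : ℝ) + 1)⁻¹ := by
    rw [harmonic, Fin.sum_univ_eq_sum_range (fun j => ((j : ℝ) + 1)⁻¹)]
    push_cast
    rfl
  rw [← e, ← Real.log_pow]
  refine le_trans (Real.log_le_log (by positivity) ?_) h
  push_cast
  linarith

/-- The decisive use of `α > 1` in the necessity part: `K^α` outgrows every linear function of `K`.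
-/
lemma exists_nat_mul_le_rpow {α : ℝ} (hα : 1 < α) {c d : ℝ} (hc : 0 < c) (hd : 0 ≤ d) (e : ℝ) :
    ∃ K : ℕ, 0 < K ∧ d * (1 + K * e) ≤ (K * c) ^ α := by
  have h1 : Tendsto (fun K : ℕ => (K : ℝ) ^ (α - 1)) atTop atTop :=
    (tendsto_rpow_atTop (by linarith)).comp tendsto_natCast_atTop_atTop
  obtain ⟨K, hK, hK0⟩ := ((h1.eventually_ge_atTop (d * (1 + e) / c ^ α)).and
    (eventually_gt_atTop 0)).exists
  refine ⟨K, hK0, ?_⟩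
  have hK1 : (1 : ℝ) ≤ K := by exact_mod_cast hK0
  have hcα : 0 < c ^ α := Real.rpow_pos_of_pos hc α
  rw [div_le_iff₀ hcα] at hK
  calc d * (1 + K * e) ≤ d * (K + K * e) := by gcongr
    _ = K * (d * (1 + e)) := by ring
    _ ≤ K * ((K : ℝ) ^ (α - 1) * c ^ α) := by gcongr
    _ = (K * c) ^ α := by
        rw [Real.mul_rpow (by positivity) hc.le, ← mul_assoc]
        nth_rewrite 1 [← Real.rpow_one (K : ℝ)]
        rw [← Real.rpow_add (by linarith), add_sub_cancel]

/-- If `Γ^q_α(w)` is a Banach space over a measure space with cells of all sizes, then `w` is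
in `B_q`. -/
theorem isBq_of_gammaIsBanach {Ω : Type*} [MeasurableSpace Ω] {μ : Measure Ω} (hcells : HasCells μ)
    {q α : ℝ} (hα : 1 < α) (hαq : α ≤ q) {w : ℝ → ℝ} (hw : IsWeight w)
    (h : GammaIsBanach μ q α w) : IsBq q w := by
  have hq : 1 < q := hα.trans_le hαq
  obtain ⟨D, hDt, hD⟩ := h.exists_average_le hα hαq hcells
  -- The `2` in `d` becomes the gain required by `isBq_of_two_mul_le`, applied with `l = 2^K`.
  obtain ⟨K, hK0, hK⟩ := exists_nat_mul_le_rpow hα (Real.log_pos one_lt_two)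
    (d := 2 * D.toReal) (by positivity) (D.toReal * 2 ^ q)
  have hKc : 0 < K * Real.log 2 := mul_pos (by exact_mod_cast hK0) (Real.log_pos one_lt_two)
  set L := ENNReal.ofReal (K * Real.log 2) with hL
  have hL0 : L ^ α ≠ 0 := by
    rw [hL, ENNReal.ofReal_rpow_of_pos hKc]
    simpa using Real.rpow_pos_of_pos hKc α
  have hLt : L ^ α ≠ ∞ := ENNReal.rpow_ne_top_of_nonneg (by linarith) ENNReal.ofReal_ne_top
  have hDL : 2 * (D * (1 + K * (D * 2 ^ q))) ≤ L ^ α := by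
    rw [hL, ENNReal.ofReal_rpow_of_pos hKc]
    refine le_trans (le_of_eq ?_) (ENNReal.ofReal_le_ofReal hK)
    rw [ENNReal.ofReal_mul (by positivity), ENNReal.ofReal_mul zero_le_two,
      ENNReal.ofReal_add zero_le_one (by positivity), ENNReal.ofReal_mul (Nat.cast_nonneg K),
      ENNReal.ofReal_mul ENNReal.toReal_nonneg, ENNReal.ofReal_toReal hDt,
      ← ENNReal.ofReal_rpow_of_pos zero_lt_two]
    simp only [ENNReal.ofReal_ofNat, ENNReal.ofReal_one, ENNReal.ofReal_natCast]
    ring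
  refine isBq_of_two_mul_le hq (l := 2 ^ K) (one_lt_pow₀ one_lt_two hK0.ne') fun r hr => ?_
  have key := harmonic_rpow_mul_weight_le hα hαq hw hDt hD K hr
  refine (ENNReal.mul_le_mul_iff_right hL0 hLt).1 ?_
  calc L ^ α * (2 * ∫⁻ s in Ioo 0 (2 ^ K * r), ENNReal.ofReal (w s))
      = 2 * (L ^ α * ∫⁻ s in Ioo 0 (2 ^ K * r), ENNReal.ofReal (w s)) := by ring
    _ ≤ 2 * (ENNReal.ofReal (∑ j : Fin (2 ^ K), ((j : ℝ) + 1)⁻¹) ^ α *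
          ∫⁻ s in Ioo 0 (2 ^ K * r), ENNReal.ofReal (w s)) := by
        gcongr
        exact ENNReal.ofReal_le_ofReal (mul_log_two_le_sum_inv K)
    _ ≤ 2 * (D * (1 + K * (D * 2 ^ q)) * ((2 : ℝ≥0∞) ^ K) ^ q *
          ∫⁻ s in Ioo 0 r, ENNReal.ofReal (w s)) := by gcongr
    _ = 2 * (D * (1 + K * (D * 2 ^ q))) * (((2 : ℝ≥0∞) ^ K) ^ q *
          ∫⁻ s in Ioo 0 r, ENNReal.ofReal (w s)) := by ring
    _ ≤ L ^ α * (((2 : ℝ≥0∞) ^ K) ^ q * ∫⁻ s in Ioo 0 r, ENNReal.ofReal (w s)) := by gcongr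
    _ = _ := by
        rw [← ENNReal.ofReal_rpow_of_pos (by positivity), ENNReal.ofReal_pow zero_le_two]
        simp

/-! ### Cells in Euclidean space and the conclusion -/

/-- Concentric annuli of equal volume. -/
lemma hasCells_euclideanSpace {n : ℕ} (hn : 1 ≤ n) :
    HasCells (volume : Measure (EuclideanSpace ℝ (Fin n))) := by
  intro r hr
  set c : ℝ := (volume (Metric.ball (0 : EuclideanSpace ℝ (Fin n)) 1)).toReal with hc
  have hct : volume (Metric.ball (0 : EuclideanSpace ℝ (Fin n)) 1) ≠ ∞ := measure_ball_lt_top.ne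
  have hc0 : 0 < c := ENNReal.toReal_pos (Metric.measure_ball_pos _ _ one_pos).ne' hct
  have hn0 : n ≠ 0 := by omega
  have : Nontrivial (EuclideanSpace ℝ (Fin n)) :=
    Module.nontrivial_of_finrank_pos (R := ℝ) (by simpa using Nat.pos_of_ne_zero hn0)
  -- `T x` is the volume of the ball of radius `‖x‖`, so preimages of intervals in `[0, ∞)` have
  -- volume equal to the length.
  set T : EuclideanSpace ℝ (Fin n) → ℝ := fun x => c * ‖x‖ ^ n with hT
  have hTm : Measurable T := by fun_prop
  have hvol : ∀ t : ℝ, 0 ≤ t → volume (T ⁻¹' Iio t) = ENNReal.ofReal t := by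
    intro t ht
    have hroot : ((t / c) ^ (1 / (n : ℝ))) ^ n = t / c := by
      rw [one_div]
      exact Real.rpow_inv_natCast_pow (by positivity) hn0
    have e : T ⁻¹' Iio t = Metric.ball 0 ((t / c) ^ (1 / (n : ℝ))) := by
      ext x
      simp only [hT, mem_preimage, mem_Iio, Metric.mem_ball, dist_zero_right]
      rw [← pow_lt_pow_iff_left₀ (norm_nonneg x) (by positivity) hn0, hroot, lt_div_iff₀ hc0,
        mul_comm]
    rw [e, Measure.addHaar_ball _ _ (by positivity), finrank_euclideanSpace_fin, hroot,
      ← ENNReal.ofReal_toReal hct, ← ENNReal.ofReal_mul (by positivity)]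
    congr 1
    exact div_mul_cancel₀ t hc0.ne'
  refine ⟨fun j => T ⁻¹' Ico (j * r) ((j + 1) * r), fun j => hTm measurableSet_Ico, ?_, fun j => ?_⟩
  · have aux : ∀ i j : ℕ, i < j → Disjoint (Ico ((i : ℝ) * r) ((i + 1) * r))
        (Ico ((j : ℝ) * r) ((j + 1) * r)) := by
      intro i j hij
      rw [Ico_disjoint_Ico]
      have h1 : ((i : ℝ) + 1) ≤ j := by exact_mod_cast hij
      exact (min_le_left _ _).trans ((mul_le_mul_of_nonneg_right h1 hr.le).trans (le_max_right _ _))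
    intro i j hij
    rcases lt_or_gt_of_ne hij with h | h
    · exact (aux i j h).preimage T
    · exact ((aux j i h).preimage T).symm
  · have e : T ⁻¹' Ico (j * r) ((j + 1) * r) = T ⁻¹' Iio ((j + 1) * r) \ T ⁻¹' Iio (j * r) := by
      rw [← preimage_sdiff]
      congr 1
      ext t
      simp
    have hle : (j : ℝ) * r ≤ (j + 1) * r := by nlinarith
    change volume (T ⁻¹' Ico (j * r) ((j + 1) * r)) = _
    rw [e, measure_sdiff (preimage_mono (Iio_subset_Iio hle))
      (hTm measurableSet_Iio).nullMeasurableSet (by rw [hvol _ (by positivity)]; exact ENNReal.ofReal_ne_top), hvol _ (by positivity),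
      hvol _ (by positivity), ← ENNReal.ofReal_sub _ (by positivity)]
    congr 1
    ring

end GammaLorentz

end

theorem mainTheorem4 (n : ℕ) (hn : 1 ≤ n) (q α : ℝ) (hα : 1 < α) (hαq : α ≤ q)
    (w : ℝ → ℝ) (hw : GammaLorentz.IsWeight w)
    (hw0 : ¬ (w =ᵐ[volume.restrict (Ioi 0)] 0)) :
    GammaLorentz.GammaIsBanach (volume : Measure (EuclideanSpace ℝ (Fin n))) q α w ↔
      GammaLorentz.IsBq q w :=
  ⟨GammaLorentz.isBq_of_gammaIsBanach (GammaLorentz.hasCells_euclideanSpace hn) hα hαq hw,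
    GammaLorentz.gammaIsBanach_of_isBq volume hα hαq hw hw0⟩
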